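/- A Dyck path $d$ of length $n$ is a lattice path from $(0,0)$ to $(n,n)$ with north steps $(0,1)$ and east steps $(1,0)$ that stays weakly above the diagonal $y=x$. Let $h_d(i)$ be the number of unit squares in column $i$ that lie below $d$, for $1\le i\le n$. The indifference graph $G(d)$ has vertex set $\{1,\dots,n\}$, and for $i<j$ it has an edge $ij$ if and only if $j\le h_d(i)$, that is, if and only if the unit square $[i-1,i]\times[j-1,j]$ lies between the path and the diagonal. The path $d$ is called abelian if $G(d)$ is co-bipartite, i.e. if the complement of $G(d)$ is a bipartite graph. For a finite graph $G$ with vertex set $V$ and an integer $k\ge 0$, the chromatic symmetric function of $G$ restricted to $k$ variables is $$X_G(x_1,\dots,x_k)=\sum_{f}\ \prod_{v\in V}x_{f(v)},$$ where the sum is over all proper colorings $f\colon V\to\{1,\dots,k\}$ of $G$. A set $J\subset\mathbb{N}^k$ is M-convex if for all $\alpha,\beta\in J$ and every $i$ with $\alpha_i>\beta_i$ there is a $j$ with $\alpha_j<\beta_j$, $\alpha-e_i+e_j\in J$ and $\beta-e_j+e_i\in J$. A homogeneous polynomial $f\in\mathbb{R}[x_1,\dots,x_k]$ of degree $n$ with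 nonnegative coefficients is called Lorentzian if the set of exponents of the monomials with nonzero coefficient in $f$ is M-convex and, when $n\ge2$, for all $i_1,\dots,i_{n-2}\in\{1,\dots,k\}$ the Hessian matrix of the quadratic form $\frac{\partial}{\partial x_{i_1}}\cdots\frac{\partial}{\partial x_{i_{n-2}}}f$ has at most one positive eigenvalue, counted with multiplicity. **Theorem.** If $d$ is an abelian Dyck path of length $n$, then for every $k\ge 0$ the polynomial $X_{G(d)}(x_1,\dots,x_k)$ is Lorentzian (homogeneous of degree $n$). -/

import Mathlib

open MvPolynomial

/-- `northBefore l i` is the number of north steps (`U`) that precede the `i`-th east step (`D`),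
counted from `0`, in the list of steps `l`. -/
def northBefore : List DyckStep → ℕ → ℕ
  | [], _ => 0
  | DyckStep.U :: l, i => northBefore l i + 1
  | DyckStep.D :: _, 0 => 0
  | DyckStep.D :: l, i + 1 => northBefore l i

/-- The Hessenberg function of a Dyck path `d` (with `U` the north step and `D` the east step):
the number of unit squares in column `i` that lie below `d`. Columns are numbered from `0`. -/
def hessenberg (d : DyckWord) (i : ℕ) : ℕ := northBefore d.toList i

/-- The indifference graph of a Dyck path `d` of length `n`. Vertices are numbered from `0`, and
for `i < j` there is an edge `ij` iff the unit square `[i, i + 1] × [j, j + 1]`, which is above the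
diagonal, lies below the path. -/
def indifferenceGraph (d : DyckWord) : SimpleGraph (Fin d.semilength) where
  Adj i j := (i < j ∧ (j : ℕ) < hessenberg d i) ∨ (j < i ∧ (i : ℕ) < hessenberg d j)
  symm := ⟨fun _ _ h => h.symm⟩
  loopless := ⟨fun i h => by
    rcases h with h | h <;> exact lt_irrefl i h.1⟩

/-- A Dyck path is abelian if its indifference graph is co-bipartite. -/
def IsAbelianDyckPath (d : DyckWord) : Prop := (indifferenceGraph d)ᶜ.IsBipartite

open Classical in
/-- The chromatic symmetric function of `G` in `k` variables: the sum of `∏ v, x (f v)` over all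
proper colorings `f` of `G` with colors in `Fin k`. -/
noncomputable def chromaticSymm {V : Type*} [Fintype V] [DecidableEq V] (G : SimpleGraph V)
    (k : ℕ) : MvPolynomial (Fin k) ℝ :=
  ∑ f ∈ (Finset.univ : Finset (V → Fin k)).filter (fun f => ∀ u v, G.Adj u v → f u ≠ f v),
    ∏ v, X (f v)

/-- M-convexity (symmetric exchange). The subtractions are never truncated, since `β i < α i` and
`α j < β j`. -/
def IsMConvex {k : ℕ} (J : Set (Fin k →₀ ℕ)) : Prop :=
  ∀ α ∈ J, ∀ β ∈ J, ∀ i, β i < α i → ∃ j, α j < β j ∧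
    α - Finsupp.single i 1 + Finsupp.single j 1 ∈ J ∧
    β - Finsupp.single j 1 + Finsupp.single i 1 ∈ J

/-- The Hessian of a quadratic form `q` in `k` variables. For such `q` the second partial
derivatives are constants, so they are given by their constant coefficients. -/
noncomputable def quadraticHessian {k : ℕ} (q : MvPolynomial (Fin k) ℝ) :
    Matrix (Fin k) (Fin k) ℝ :=
  Matrix.of fun r s => constantCoeff (pderiv r (pderiv s q))

/-- The iterated partial derivative of `f` along the list of variables `l`. -/
noncomputable def iteratedPderiv {k : ℕ} (l : List (Fin k)) (f : MvPolynomial (Fin k) ℝ) :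
    MvPolynomial (Fin k) ℝ :=
  l.foldr (fun i g => pderiv i g) f

/-- A matrix has at most one positive eigenvalue, counted with multiplicity. -/
def AtMostOnePosEigenvalue {k : ℕ} (H : Matrix (Fin k) (Fin k) ℝ) : Prop :=
  Multiset.card (H.charpoly.roots.filter fun t : ℝ => 0 < t) ≤ 1

/-- Lorentzian polynomials of degree `n` in `k` variables. The condition on derivatives of order
`n - 2` is empty for `n < 2`. -/
structure IsLorentzian {k : ℕ} (n : ℕ) (f : MvPolynomial (Fin k) ℝ) : Prop where
  isHomogeneous : f.IsHomogeneous n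
  coeff_nonneg : ∀ α, 0 ≤ f.coeff α
  mConvex : IsMConvex {α | f.coeff α ≠ 0}
  hessian : ∀ l : List (Fin k), l.length + 2 = n →
    AtMostOnePosEigenvalue (quadraticHessian (iteratedPderiv l f))

/-!
The complement of `G(d)` is the comparability graph of a poset, so if it is bipartite the poset has
no chain of length three. Hence the vertices `v < s`, with `s = hessenberg d 0`, and the vertices
`v ≥ s` form two cliques, and, since `hessenberg d` is monotone, the non-edges between the two
cliques form a Ferrers board. This is the isomorphism `ferrersGraphIso`. A color class of a proper
coloring is then a single vertex or a cell of the board, and the classes of size two form a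
non-attacking rook placement. With `n = s + t` vertices, the coefficient of `x ^ α` in the chromatic
symmetric function is therefore `w j = r j * j! * (n - 2 * j)!` if `α` has entries at most `2`,
sum `n` and `j` entries equal to `2`, where `r j` is the `j`-th rook number of the board, and it is
`0` otherwise (`coloringCount_ferrersGraph`). To count, the colorings with `j` shared colors are
built by adding the rows of the board in increasing order (`card_isFerrersInjection`), and this
total is divided among the exponents `α`, which are all equivalent under permutations of the colors.

The support consists of the `α` with entries at most `2`, sum `n` and a bounded number of entries
`2`, and is M-convex (`isMConvex_boundedLevel`). A derivative of order `n - 2` along `μ` is a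
quadratic form in the variables with `μ i = 1` (`b` of them) and those with `μ i = 0`; it depends
only on `w a`, `w (a + 1)`, `w (a + 2)`, where `a` is the number of entries `2` of `μ`. By the
Cauchy-Schwarz inequality it is nonpositive on a hyperplane as soon as `2 * w (a + 1) ≤ w a`,
`(b - 1) * w (a + 2) * w a ≤ b * w (a + 1) ^ 2` and `2 * (b - 1) * w (a + 2) ≤ b * w (a + 1)`
(`exists_functional_nonpos`), and then its Hessian has at most one positive eigenvalue.

These inequalities come from the rook densities `R j = r j / (s.choose j * t.descFactorial j)`,
for which `w j = s! * t! * R j * (n - 2 * j).choose (s - j)`: the sequence `R` is decreasing and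
log-concave. Adding to a board with `p` rows a row of length `l`, at least as long as the others,
changes it by
`(p + 1) * R' j = (p + 1 - j) * R j + j * θ j * R (j - 1)` with `θ j = (l - j + 1) / (t - j + 1)`.
For constant `θ` this is the recursion of the normalized elementary symmetric means, and the
inductive proof of Newton's inequalities still works because `θ` is decreasing and concave
(`newton_step`, `rookDensity_logConcave`).
-/

open scoped Nat

/-! ### Rook numbers of Ferrers boards -/

/-- The number of placements of `j` non-attacking rooks on the board with `p` rows, of which row `q`
consists of the first `L q` cells, for monotone `L`. It is defined through the recursion that
removes the longest row: a rook in row `p` avoids the columns of the other `j` rooks, which all lie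
in that row's range. If `L p < j`, the factor `L p - j` is negative, but the rook number that it
multiplies is `0`. -/
noncomputable def rookNumber (L : ℕ → ℕ) : ℕ → ℕ → ℝ
  | 0, 0 => 1
  | 0, _ + 1 => 0
  | p + 1, 0 => rookNumber L p 0
  | p + 1, j + 1 => rookNumber L p (j + 1) + ((L p : ℝ) - j) * rookNumber L p j

section Rook

variable {L : ℕ → ℕ}

lemma rookNumber_succ_succ (L : ℕ → ℕ) (p j : ℕ) : rookNumber L (p + 1) (j + 1) =
    rookNumber L p (j + 1) + ((L p : ℝ) - j) * rookNumber L p j := rfl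

lemma rookNumber_zero_right (L : ℕ → ℕ) (p : ℕ) : rookNumber L p 0 = 1 := by
  induction p with
  | zero => rfl
  | succ p ih => exact ih

lemma rookNumber_eq_zero_of_lt (L : ℕ → ℕ) {p j : ℕ} (h : p < j) : rookNumber L p j = 0 := by
  induction p generalizing j with
  | zero => obtain ⟨j, rfl⟩ := Nat.exists_eq_succ_of_ne_zero h.ne'; rfl
  | succ p ih =>
    obtain ⟨j, rfl⟩ := Nat.exists_eq_succ_of_ne_zero (Nat.ne_zero_of_lt h)
    rw [Nat.succ_eq_add_one, rookNumber_succ_succ, ih (by omega), ih (by omega)]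
    ring

lemma rookNumber_eq_zero_of_rows_lt (hL : Monotone L) {p j : ℕ} (hj : 0 < j)
    (h : ∀ q < p, L q < j) : rookNumber L p j = 0 := by
  induction p generalizing j with
  | zero => exact rookNumber_eq_zero_of_lt L hj
  | succ p ih =>
    obtain ⟨j, rfl⟩ := Nat.exists_eq_succ_of_ne_zero hj.ne'
    rw [Nat.succ_eq_add_one, rookNumber_succ_succ, ih hj fun q hq => h q (by omega), zero_add]
    have hp := h p (by omega)
    rcases eq_or_lt_of_le (Nat.lt_succ_iff.mp hp) with h1 | h1
    · simp [h1]
    · rw [ih (by omega) fun q hq => (hL hq.le).trans_lt h1, mul_zero]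

lemma rookNumber_mul_nonneg (hL : Monotone L) (p j : ℕ) (hr : 0 ≤ rookNumber L p j) :
    0 ≤ ((L p : ℝ) - j) * rookNumber L p j := by
  rcases le_or_gt j (L p) with h | h
  · have : (j : ℝ) ≤ L p := by exact_mod_cast h
    exact mul_nonneg (by linarith) hr
  · rw [rookNumber_eq_zero_of_rows_lt hL (by omega) fun q hq => (hL hq.le).trans_lt h, mul_zero]

lemma rookNumber_nonneg (hL : Monotone L) (p j : ℕ) : 0 ≤ rookNumber L p j := by
  induction p generalizing j with
  | zero => cases j <;> simp [rookNumber]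
  | succ p ih =>
    cases j with
    | zero => exact ih 0
    | succ j => exact add_nonneg (ih _) (rookNumber_mul_nonneg hL p j (ih j))

lemma rookNumber_succ_eq_zero (hL : Monotone L) {p j : ℕ} (h : rookNumber L p j = 0) :
    rookNumber L p (j + 1) = 0 := by
  induction p generalizing j with
  | zero => rfl
  | succ p ih =>
    cases j with
    | zero => simp [rookNumber_zero_right] at h
    | succ j =>
      rw [rookNumber_succ_succ] at h
      have h1 : rookNumber L p (j + 1) = 0 := by
        linarith [rookNumber_nonneg hL p (j + 1),
          rookNumber_mul_nonneg hL p j (rookNumber_nonneg hL p j)]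
      rw [rookNumber_succ_succ, ih h1, h1]
      ring

lemma rookNumber_eq_zero_of_le (hL : Monotone L) {p i j : ℕ} (hij : i ≤ j)
    (h : rookNumber L p i = 0) : rookNumber L p j = 0 := by
  induction j, hij using Nat.le_induction with
  | base => exact h
  | succ j _ ih => exact rookNumber_succ_eq_zero hL ih

/-- The `j`-th rook number of a board with `p` rows and `t` columns, divided by the `j`-th rook
number of the full `p × t` rectangle. For `j > p` or `j > t` it is the junk value `0`. -/
noncomputable def rookDensity (L : ℕ → ℕ) (t p j : ℕ) : ℝ :=
  rookNumber L p j / (p.choose j * t.descFactorial j)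

lemma rookDensity_nonneg (hL : Monotone L) (t p j : ℕ) : 0 ≤ rookDensity L t p j :=
  div_nonneg (rookNumber_nonneg hL p j) (by positivity)

lemma rookDensity_zero_right (t p : ℕ) : rookDensity L t p 0 = 1 := by
  simp [rookDensity, rookNumber_zero_right]

lemma rookDensity_eq_zero {t p j : ℕ} (h : rookNumber L p j = 0) : rookDensity L t p j = 0 := by
  simp [rookDensity, h]

lemma rookNumber_eq_density {t p j : ℕ} (hj : j ≤ t) :
    rookNumber L p j = rookDensity L t p j * (p.choose j * t.descFactorial j) := by
  rcases le_or_gt j p with hp | hp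
  · have h1 : (p.choose j : ℝ) ≠ 0 := by exact_mod_cast (Nat.choose_pos hp).ne'
    have h2 : (t.descFactorial j : ℝ) ≠ 0 := by
      exact_mod_cast (Nat.pos_of_ne_zero fun h => by
        rw [Nat.descFactorial_eq_zero_iff_lt] at h; omega).ne'
    rw [rookDensity, div_mul_cancel₀ _ (mul_ne_zero h1 h2)]
  · simp [rookNumber_eq_zero_of_lt L hp, Nat.choose_eq_zero_of_lt hp]

/-- The recursion of the densities that adds a row. The density of the larger board is a weighted mean
of two densities of the smaller one, up to the factor `(L p - j) / (t - j)`. -/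
lemma rookDensity_succ_succ {t p j : ℕ} (hj : j + 1 ≤ t) :
    (p + 1 : ℝ) * rookDensity L t (p + 1) (j + 1) =
      ((p : ℝ) - j) * rookDensity L t p (j + 1) +
        (j + 1) * (((L p : ℝ) - j) / ((t : ℝ) - j)) * rookDensity L t p j := by
  rcases lt_or_ge p j with hp | hp
  · rw [rookDensity_eq_zero (rookNumber_eq_zero_of_lt L (by omega)),
      rookDensity_eq_zero (rookNumber_eq_zero_of_lt L (by omega)),
      rookDensity_eq_zero (rookNumber_eq_zero_of_lt L (by omega))]
    ring
  have hrec := rookNumber_succ_succ L p j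
  rw [rookNumber_eq_density hj, rookNumber_eq_density (t := t) (p := p) hj,
    rookNumber_eq_density (t := t) (j := j) (by omega), Nat.descFactorial_succ] at hrec
  have htj : (0 : ℝ) < (t : ℝ) - j := by
    have : ((j + 1 : ℕ) : ℝ) ≤ t := by exact_mod_cast hj
    push_cast at this; linarith
  have hc1 : ((p + 1).choose (j + 1) : ℝ) * (j + 1) = (p + 1) * p.choose j := by
    exact_mod_cast (Nat.add_one_mul_choose_eq p j).symm
  have hc2 : (p.choose (j + 1) : ℝ) * (j + 1) = p.choose j * ((p : ℝ) - j) := by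
    rw [← Nat.cast_sub hp]; exact_mod_cast Nat.choose_succ_right_eq p j
  have hC : (0 : ℝ) < p.choose j := by exact_mod_cast Nat.choose_pos hp
  have hD : (0 : ℝ) < t.descFactorial j := by
    exact_mod_cast (Nat.pos_of_ne_zero fun h => by
        rw [Nat.descFactorial_eq_zero_iff_lt] at h; omega)
  have hJ : (0 : ℝ) < (j : ℝ) + 1 := by positivity
  push_cast [Nat.cast_sub (show j ≤ t by omega)] at hrec
  rw [eq_div_of_mul_eq hJ.ne' hc1, eq_div_of_mul_eq hJ.ne' hc2] at hrec
  field_simp at hrec ⊢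
  linarith

/-- The inductive step of Newton's inequalities, for factors `θ₁ ≥ θ₂ ≥ θ₃ ≥ 0` that form a concave
sequence. The difference of the two sides is at least `(a₂ - θ₂ * a₁) ^ 2`. -/
lemma newton_step {a₀ a₁ a₂ a₃ θ₁ θ₂ θ₃ s j : ℝ} (h0 : 0 ≤ a₀) (h1 : 0 ≤ a₁) (h2 : 0 ≤ a₂)
    (h02 : a₀ * a₂ ≤ a₁ ^ 2) (h13 : a₁ * a₃ ≤ a₂ ^ 2) (h03 : a₀ * a₃ ≤ a₁ * a₂)
    (hθ₃ : 0 ≤ θ₃) (hθ₂ : θ₃ ≤ θ₂) (hθ₁ : θ₂ ≤ θ₁) (hθ : θ₁ + θ₃ ≤ 2 * θ₂)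
    (hj : 1 ≤ j) (hs : j + 1 ≤ s) :
    ((s - j + 1) * a₁ + (j - 1) * θ₁ * a₀) * ((s - j - 1) * a₃ + (j + 1) * θ₃ * a₂) ≤
      ((s - j) * a₂ + j * θ₂ * a₁) ^ 2 := by
  have hA : (s - j + 1) * (s - j - 1) * (a₁ * a₃) ≤ ((s - j) ^ 2 - 1) * a₂ ^ 2 := by
    have := mul_le_mul_of_nonneg_left h13
      (mul_nonneg (by linarith : 0 ≤ s - j + 1) (by linarith : 0 ≤ s - j - 1))
    nlinarith
  have hθ13 : θ₁ * θ₃ ≤ θ₂ ^ 2 := by nlinarith [sq_nonneg (θ₁ - θ₃)]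
  have hC : (j - 1) * (j + 1) * (θ₁ * θ₃) * (a₀ * a₂) ≤ (j ^ 2 - 1) * θ₂ ^ 2 * a₁ ^ 2 := by
    have h := mul_le_mul hθ13 h02 (mul_nonneg h0 h2) (sq_nonneg _)
    have := mul_le_mul_of_nonneg_left h
      (mul_nonneg (by linarith : 0 ≤ j - 1) (by linarith : 0 ≤ j + 1))
    nlinarith
  have hB1 : (j - 1) * (s - j - 1) * θ₁ * (a₀ * a₃) ≤ (j - 1) * (s - j - 1) * θ₁ * (a₁ * a₂) :=
    mul_le_mul_of_nonneg_left h03 (mul_nonneg (mul_nonneg (by linarith) (by linarith))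
      (by linarith))
  have hB2 : (s - j + 1) * (j + 1) * θ₃ + (j - 1) * (s - j - 1) * θ₁ ≤
      (2 * j * (s - j) + 2) * θ₂ := by
    have e1 : 0 ≤ (s - j + 1) * (j + 1) * (2 * θ₂ - θ₁ - θ₃) :=
      mul_nonneg (mul_nonneg (by linarith) (by linarith)) (by linarith)
    have e2 : 0 ≤ s * (θ₁ - θ₂) := mul_nonneg (by linarith) (by linarith)
    nlinarith
  have hB3 := mul_le_mul_of_nonneg_right hB2 (mul_nonneg h1 h2)
  nlinarith [sq_nonneg (a₂ - θ₂ * a₁)]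

lemma rowRatio_nonneg {l t i : ℕ} (hi : i ≤ l) (hl : l ≤ t) :
    (0 : ℝ) ≤ ((l : ℝ) - i) / ((t : ℝ) - i) := by
  have h1 : (i : ℝ) ≤ l := by exact_mod_cast hi
  have h2 : (l : ℝ) ≤ t := by exact_mod_cast hl
  exact div_nonneg (by linarith) (by linarith)

lemma rowRatio_antitone {l t i : ℕ} (hl : l ≤ t) (hi : i + 2 ≤ t) :
    ((l : ℝ) - (i + 1)) / ((t : ℝ) - (i + 1)) ≤ ((l : ℝ) - i) / ((t : ℝ) - i) := by
  have h2 : (l : ℝ) ≤ t := by exact_mod_cast hl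
  have h3 : ((i + 2 : ℕ) : ℝ) ≤ t := by exact_mod_cast hi
  push_cast at h3
  rw [div_le_div_iff₀ (by linarith) (by linarith)]
  nlinarith

lemma rowRatio_concave {l t i : ℕ} (hl : l ≤ t) (hi : i + 3 ≤ t) :
    ((l : ℝ) - i) / ((t : ℝ) - i) + ((l : ℝ) - (i + 2)) / ((t : ℝ) - (i + 2)) ≤
      2 * (((l : ℝ) - (i + 1)) / ((t : ℝ) - (i + 1))) := by
  have h2 : (l : ℝ) ≤ t := by exact_mod_cast hl
  have h3 : ((i + 3 : ℕ) : ℝ) ≤ t := by exact_mod_cast hi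
  push_cast at h3
  obtain ⟨c, hc⟩ : ∃ c : ℝ, (l : ℝ) = t - c := ⟨t - l, by ring⟩
  obtain ⟨x, hx⟩ : ∃ x : ℝ, (t : ℝ) = x + i + 1 := ⟨t - i - 1, by ring⟩
  have hx2 : 2 ≤ x := by linarith
  have hc0 : 0 ≤ c := by linarith
  rw [hc, hx, show x + i + 1 - (i : ℝ) = x + 1 by ring,
    show x + i + 1 - ((i : ℝ) + 2) = x - 1 by ring, show x + i + 1 - ((i : ℝ) + 1) = x by ring,
    show x + i + 1 - c - (i : ℝ) = (x + 1) - c by ring,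
    show x + i + 1 - c - ((i : ℝ) + 2) = (x - 1) - c by ring,
    show x + i + 1 - c - ((i : ℝ) + 1) = x - c by ring,
    sub_div (x + 1) c, sub_div (x - 1) c, sub_div x c, div_self (by linarith),
    div_self (by linarith), div_self (by linarith)]
  have : 2 * (c / x) ≤ c / (x + 1) + c / (x - 1) := by
    rw [div_add_div _ _ (by linarith) (by linarith), ← mul_div_assoc,
      div_le_div_iff₀ (by linarith) (by nlinarith)]
    nlinarith
  linarith

/-- Rook densities of a Ferrers board are log-concave. This can fail for other boards, for instance
for the diagonal of a square. -/
theorem rookDensity_logConcave (hL : Monotone L) {t : ℕ} (ht : ∀ q, L q ≤ t) (p i : ℕ)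
    (hi : i + 2 ≤ t) : rookDensity L t p i * rookDensity L t p (i + 2) ≤
      rookDensity L t p (i + 1) ^ 2 := by
  induction p generalizing i with
  | zero =>
    rw [rookDensity_eq_zero (j := i + 2) (rookNumber_eq_zero_of_lt L (by omega)), mul_zero]
    positivity
  | succ p ih =>
    -- If the last rook number is nonzero, all the factors `θ` are nonnegative.
    by_cases hz : rookNumber L (p + 1) (i + 2) = 0
    · rw [rookDensity_eq_zero hz, mul_zero]; positivity
    have hp : i + 2 ≤ p + 1 := by
      by_contra h
      exact hz (rookNumber_eq_zero_of_lt L (by omega))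
    have hLp : i + 1 ≤ L p := by
      by_contra h
      exact hz (rookNumber_eq_zero_of_rows_lt hL (by omega) fun q hq =>
        (hL (Nat.lt_succ_iff.mp hq)).trans_lt (by omega))
    have nn := fun j => rookDensity_nonneg hL t p j
    have e2 := rookDensity_succ_succ (L := L) (p := p) (show i + 1 ≤ t by omega)
    have e3 := rookDensity_succ_succ (L := L) (p := p) (show (i + 1) + 1 ≤ t by omega)
    have hpr : ((i + 1 : ℕ) : ℝ) ≤ p := by exact_mod_cast (by omega : i + 1 ≤ p)
    push_cast at hpr e3
    have hp1 : (0 : ℝ) < p + 1 := by positivity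
    have r3 := rowRatio_nonneg hLp (ht p)
    have r23 := rowRatio_antitone (ht p) hi
    push_cast at r3
    refine le_of_mul_le_mul_left ?_ (pow_pos hp1 2)
    cases i with
    | zero =>
      have := newton_step (s := p + 1) (j := 1) le_rfl (nn 0) (nn 1)
        (by simpa using sq_nonneg (rookDensity L t p 0)) (ih 0 hi)
        (by simpa using mul_nonneg (nn 0) (nn 1)) r3 r23
        (le_refl _) (by push_cast at r23 ⊢; linarith) le_rfl (by push_cast at hpr; linarith)
      simp only [rookDensity_zero_right] at this e2 e3 ⊢
      push_cast at this e2 e3 ⊢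
      calc _ = ((p : ℝ) + 1) * ((p + 1) * rookDensity L t (p + 1) (0 + 2)) := by ring
        _ ≤ ((p + 1) * rookDensity L t (p + 1) (0 + 1)) ^ 2 := by
          rw [e2, e3]; norm_num at this ⊢; linarith
        _ = _ := by ring
    | succ i =>
      have e1 := rookDensity_succ_succ (L := L) (p := p) (show i + 1 ≤ t by omega)
      have r12 := rowRatio_antitone (i := i) (ht p) (by omega)
      have rc := rowRatio_concave (i := i) (ht p) (by omega)
      -- Log-concavity skips no zeros, because a vanishing rook number forces the later ones to vanish.
      have h03 : rookDensity L t p i * rookDensity L t p (i + 3) ≤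
          rookDensity L t p (i + 1) * rookDensity L t p (i + 2) := by
        rcases (mul_nonneg (nn (i + 1)) (nn (i + 2))).eq_or_lt' with h | h
        · have : rookDensity L t p (i + 3) = 0 := by
            apply rookDensity_eq_zero
            rcases mul_eq_zero.mp h with h | h
            · refine rookNumber_eq_zero_of_le hL (i := i + 1) (by omega) ?_
              rw [rookNumber_eq_density (t := t) (by omega), h, zero_mul]
            · refine rookNumber_eq_zero_of_le hL (i := i + 2) (by omega) ?_
              rw [rookNumber_eq_density (t := t) (by omega), h, zero_mul]
          rw [this, mul_zero, h]
        · refine le_of_mul_le_mul_left ?_ h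
          have := mul_le_mul (ih i (by omega)) (ih (i + 1) hi)
            (mul_nonneg (nn _) (nn _)) (sq_nonneg _)
          calc _ = rookDensity L t p i * rookDensity L t p (i + 2) *
              (rookDensity L t p (i + 1) * rookDensity L t p (i + 1 + 2)) := by ring
            _ ≤ _ := this
            _ = _ := by ring
      push_cast at r3 r23 e2 e3 hpr
      have := newton_step (s := p + 1) (j := i + 2) (nn i) (nn (i + 1)) (nn (i + 2))
        (ih i (by omega)) (ih (i + 1) hi) h03
        (θ₁ := ((L p : ℝ) - i) / (t - i)) (θ₂ := ((L p : ℝ) - (i + 1)) / (t - (i + 1)))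
        (θ₃ := ((L p : ℝ) - (i + 2)) / (t - (i + 2)))
        (by rwa [show (i : ℝ) + 1 + 1 = i + 2 by ring] at r3)
        (by rwa [show (i : ℝ) + 1 + 1 = i + 2 by ring] at r23) r12 rc
        (by linarith [(Nat.cast_nonneg i : (0 : ℝ) ≤ i)]) (by linarith)
      rw [show (i : ℝ) + 1 + 1 = i + 2 by ring] at e2 e3
      calc _ = ((p + 1) * rookDensity L t (p + 1) (i + 1)) *
            ((p + 1) * rookDensity L t (p + 1) (i + 1 + 2)) := by ring
        _ ≤ ((p + 1) * rookDensity L t (p + 1) (i + 1 + 1)) ^ 2 := by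
          rw [e1, e2, show i + 1 + 2 = i + 1 + 1 + 1 from rfl, e3]
          refine le_trans (le_of_eq ?_) (this.trans (le_of_eq ?_))
          · ring
          · ring
        _ = _ := by ring

theorem rookDensity_succ_le (hL : Monotone L) {t : ℕ} (ht : ∀ q, L q ≤ t) (p i : ℕ)
    (hi : i + 1 ≤ t) : rookDensity L t p (i + 1) ≤ rookDensity L t p i := by
  induction p generalizing i with
  | zero =>
    rw [rookDensity_eq_zero (j := i + 1) (rookNumber_eq_zero_of_lt L (by omega))]
    exact rookDensity_nonneg hL _ _ _
  | succ p ih =>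
    have nn := fun j => rookDensity_nonneg hL t p j
    by_cases hz : rookNumber L (p + 1) (i + 1) = 0
    · rw [rookDensity_eq_zero hz]; exact rookDensity_nonneg hL _ _ _
    have hp : i ≤ p := by
      by_contra h
      exact hz (rookNumber_eq_zero_of_lt L (by omega))
    have hLp : i + 1 ≤ L p := by
      by_contra h
      exact hz (rookNumber_eq_zero_of_rows_lt hL (by omega) fun q hq =>
        (hL (Nat.lt_succ_iff.mp hq)).trans_lt (by omega))
    have e2 := rookDensity_succ_succ (L := L) (p := p) hi
    have hpr : (i : ℝ) ≤ p := by exact_mod_cast hp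
    have hp1 : (0 : ℝ) < p + 1 := by positivity
    have hi0 : (0 : ℝ) ≤ i := by positivity
    have r2 := rowRatio_nonneg (show i ≤ L p by omega) (ht p)
    have r2' : ((L p : ℝ) - i) / ((t : ℝ) - i) ≤ 1 := by
      have h1 : (L p : ℝ) ≤ t := by exact_mod_cast ht p
      have h2 : (i : ℝ) + 1 ≤ t := by exact_mod_cast hi
      rw [div_le_one (by linarith)]; linarith
    refine le_of_mul_le_mul_left ?_ hp1
    rw [e2]
    have m1 := mul_le_mul_of_nonneg_left (ih i hi) (sub_nonneg.2 hpr)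
    have m2 := mul_le_mul_of_nonneg_right r2' (nn i)
    cases i with
    | zero =>
      simp only [rookDensity_zero_right] at m1 m2 ⊢
      push_cast at m1 m2 ⊢
      linarith
    | succ i =>
      have e1 := rookDensity_succ_succ (L := L) (p := p) (show i + 1 ≤ t by omega)
      have r12 := rowRatio_antitone (i := i) (ht p) (by omega)
      rw [e1]
      push_cast at r2 r12 m1 m2 hi0 ⊢
      have m3 := mul_le_mul r12 (ih i (by omega)) (nn _) (r2.trans r12)
      have m4 := mul_le_mul_of_nonneg_left m3 hi0
      linarith

end Rook

/-- The number of proper colorings with `j` color classes of size two and the remaining `s + t - 2 * j`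
classes of size one, with a fixed exponent vector: choose the rook placement, and color its cells
and the remaining vertices. If `s + t < 2 * j`, the rook number is `0` when `L q ≤ t`. -/
noncomputable def coloringNumber (L : ℕ → ℕ) (s t j : ℕ) : ℝ :=
  rookNumber L s j * j ! * (s + t - 2 * j)!

/-! ### The coefficients of the chromatic symmetric function -/

section ColoringNumber

variable {L : ℕ → ℕ}

lemma coloringNumber_nonneg (hL : Monotone L) (s t j : ℕ) : 0 ≤ coloringNumber L s t j :=
  mul_nonneg (mul_nonneg (rookNumber_nonneg hL s j) (by positivity)) (by positivity)

lemma coloringNumber_eq_zero_iff {s t j : ℕ} :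
    coloringNumber L s t j = 0 ↔ rookNumber L s j = 0 := by
  simp [coloringNumber, Nat.factorial_ne_zero]

lemma le_of_rookNumber_ne_zero (hL : Monotone L) {s t j : ℕ} (ht : ∀ q, L q ≤ t)
    (h : rookNumber L s j ≠ 0) : j ≤ s ∧ j ≤ t := by
  refine ⟨?_, ?_⟩
  · by_contra h'
    exact h (rookNumber_eq_zero_of_lt L (by omega))
  · by_contra h'
    exact h (rookNumber_eq_zero_of_rows_lt hL (by omega) fun q _ => (ht q).trans_lt (by omega))

lemma coloringNumber_eq (L : ℕ → ℕ) (u v j : ℕ) : coloringNumber L (u + j) (v + j) j =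
    (u + j)! * (v + j)! * (rookDensity L (v + j) (u + j) j * (u + v).choose u) := by
  have h1 : ((u + j).choose j : ℝ) * j ! * u ! = (u + j)! := by
    have := Nat.choose_mul_factorial_mul_factorial (show j ≤ u + j by omega)
    rw [Nat.add_sub_cancel] at this
    exact_mod_cast this
  have h2 : (u ! : ℝ) * v ! * (u + v).choose u = (u + v)! := by
    have := Nat.choose_mul_factorial_mul_factorial (show u ≤ u + v by omega)
    rw [Nat.add_sub_cancel_left] at this
    rw [mul_comm, ← mul_assoc]
    exact_mod_cast this
  have h3 : (v ! : ℝ) * (v + j).descFactorial j = (v + j)! := by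
    have := Nat.factorial_mul_descFactorial (show j ≤ v + j by omega)
    rw [Nat.add_sub_cancel] at this
    exact_mod_cast this
  rw [coloringNumber, rookNumber_eq_density (t := v + j) (by omega),
    show u + j + (v + j) - 2 * j = u + v by omega, ← h1, ← h2, ← h3]
  ring

lemma two_mul_coloringNumber_succ_le (hL : Monotone L) {s t : ℕ} (ht : ∀ q, L q ≤ t) (a : ℕ) :
    2 * coloringNumber L s t (a + 1) ≤ coloringNumber L s t a := by
  by_cases hz : rookNumber L s (a + 1) = 0
  · rw [coloringNumber_eq_zero_iff.2 hz, mul_zero]; exact coloringNumber_nonneg hL _ _ _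
  obtain ⟨hs, ht'⟩ := le_of_rookNumber_ne_zero hL ht hz
  obtain ⟨u, rfl⟩ := Nat.exists_eq_add_of_le' hs
  obtain ⟨v, rfl⟩ := Nat.exists_eq_add_of_le' ht'
  have e0 := coloringNumber_eq L (u + 1) (v + 1) a
  rw [show u + 1 + a = u + (a + 1) by ring, show v + 1 + a = v + (a + 1) by ring] at e0
  rw [e0, coloringNumber_eq, mul_left_comm]
  refine mul_le_mul_of_nonneg_left ?_ (by positivity)
  have hR := rookDensity_succ_le hL ht (u + (a + 1)) a (by omega)
  have hC : 2 * (u + v).choose u ≤ (u + 1 + (v + 1)).choose (u + 1) := by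
    rw [show u + 1 + (v + 1) = u + v + 1 + 1 by ring, Nat.choose_succ_succ', Nat.choose_succ_succ']
    cases u with
    | zero => simp; omega
    | succ u => have := Nat.choose_succ_succ' (u + 1 + v) u; have := Nat.choose_succ_succ' (u + v) u; omega
  have hC' : (2 * (u + v).choose u : ℝ) ≤ (u + 1 + (v + 1)).choose (u + 1) := by exact_mod_cast hC
  rw [mul_left_comm]
  exact mul_le_mul hR hC' (by positivity) (rookDensity_nonneg hL _ _ _)

lemma centralChoose_rec (u v : ℕ) :
    ((u + 1 + (v + 1)).choose (u + 1) : ℝ) * ((u + 1) * (v + 1)) =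
      (u + v + 2) * (u + v + 1) * (u + v).choose u := by
  have h1 := Nat.add_one_mul_choose_eq (u + v + 1) u
  have h2 := Nat.choose_mul_succ_eq (u + v) u
  rw [show u + v + 1 - u = v + 1 by omega] at h2
  rw [show u + 1 + (v + 1) = u + v + 1 + 1 by ring]
  have h1' : ((u : ℝ) + v + 1 + 1) * (u + v + 1).choose u =
    (u + v + 1 + 1).choose (u + 1) * (u + 1) := by exact_mod_cast h1
  have h2' : ((u + v).choose u : ℝ) * (u + v + 1) = (u + v + 1).choose u * (v + 1) := by
    exact_mod_cast h2
  linear_combination (-((v : ℝ) + 1)) * h1' - (u + v + 2 : ℝ) * h2'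

/-- The inequalities behind the signature of the Hessian. For `b ≤ 1` the left-hand sides are
nonpositive. -/
lemma coloringNumber_newton (hL : Monotone L) {s t : ℕ} (ht : ∀ q, L q ≤ t) (a b : ℕ)
    (hab : 2 * a + b + 2 = s + t) :
    ((b : ℝ) - 1) * (coloringNumber L s t (a + 2) * coloringNumber L s t a) ≤
        b * coloringNumber L s t (a + 1) ^ 2 ∧
      2 * ((b : ℝ) - 1) * coloringNumber L s t (a + 2) ≤ b * coloringNumber L s t (a + 1) := by
  by_cases hz : rookNumber L s (a + 2) = 0
  · rw [coloringNumber_eq_zero_iff.2 hz]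
    refine ⟨?_, ?_⟩
    · rw [zero_mul, mul_zero]; positivity
    · rw [mul_zero]; exact mul_nonneg (by positivity) (coloringNumber_nonneg hL _ _ _)
  obtain ⟨hs, ht'⟩ := le_of_rookNumber_ne_zero hL ht hz
  obtain ⟨u, rfl⟩ := Nat.exists_eq_add_of_le' hs
  obtain ⟨v, rfl⟩ := Nat.exists_eq_add_of_le' ht'
  obtain rfl : b = u + v + 2 := by omega
  have e0 := coloringNumber_eq L (u + 1 + 1) (v + 1 + 1) a
  have e1 := coloringNumber_eq L (u + 1) (v + 1) (a + 1)
  rw [show u + 1 + 1 + a = u + (a + 2) by ring, show v + 1 + 1 + a = v + (a + 2) by ring] at e0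
  rw [show u + 1 + (a + 1) = u + (a + 2) by ring, show v + 1 + (a + 1) = v + (a + 2) by ring] at e1
  rw [e0, e1, coloringNumber_eq]
  have c1 := centralChoose_rec u v
  have c0 := centralChoose_rec (u + 1) (v + 1)
  have hR := rookDensity_succ_le hL ht (u + (a + 2)) (a + 1) (by omega)
  have hR2 := rookDensity_logConcave hL ht (u + (a + 2)) a (by omega)
  have n0 := rookDensity_nonneg hL (v + (a + 2)) (u + (a + 2)) a
  have n1 := rookDensity_nonneg hL (v + (a + 2)) (u + (a + 2)) (a + 1)
  have n2 := rookDensity_nonneg hL (v + (a + 2)) (u + (a + 2)) (a + 2)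
  rw [show a + 1 + 1 = a + 2 from rfl] at hR
  generalize rookDensity L (v + (a + 2)) (u + (a + 2)) a = R0 at *
  generalize rookDensity L (v + (a + 2)) (u + (a + 2)) (a + 1) = R1 at *
  generalize rookDensity L (v + (a + 2)) (u + (a + 2)) (a + 2) = R2 at *
  have hc : (0 : ℝ) ≤ ((u + (a + 2))! * (v + (a + 2))! : ℝ) := by positivity
  generalize ((u + (a + 2))! * (v + (a + 2))! : ℝ) = c at *
  have p2 : (0 : ℝ) ≤ (u + v).choose u := by positivity
  have p1 : (0 : ℝ) ≤ (u + 1 + (v + 1)).choose (u + 1) := by positivity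
  have p0 : (0 : ℝ) ≤ (u + 1 + 1 + (v + 1 + 1)).choose (u + 1 + 1) := by positivity
  generalize ((u + v).choose u : ℝ) = C2 at *
  generalize ((u + 1 + (v + 1)).choose (u + 1) : ℝ) = C1 at *
  generalize ((u + 1 + 1 + (v + 1 + 1)).choose (u + 1 + 1) : ℝ) = C0 at *
  push_cast at c0 ⊢
  have hu : (0 : ℝ) ≤ u := by positivity
  have hv : (0 : ℝ) ≤ v := by positivity
  generalize (u : ℝ) = u at *
  generalize (v : ℝ) = v at *
  have hB : 0 ≤ u + v + 1 := by linarith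
  -- With `b = u + v + 2`, the central binomial coefficients `C2`, `C1`, `C0` of `u + v`, `u + v + 2`,
  -- `u + v + 4` satisfy the two inequalities; these are then multiplied by the inequalities
  -- between the densities.
  have k1 : (u + v + 2 - 1) * (C2 * C0) ≤ (u + v + 2) * C1 ^ 2 := by
    have q : (0 : ℝ) < (u + v + 2) * ((u + 2) * (v + 2)) := by positivity
    refine le_of_mul_le_mul_left ?_ q
    have e : (u + v + 2) * ((u + 2) * (v + 2)) * ((u + v + 2 - 1) * (C2 * C0)) =
        (u + v + 4) * (u + v + 3) * ((u + 1) * (v + 1)) * C1 ^ 2 := by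
      linear_combination (u + v + 2) * (u + v + 1) * C2 * c0 -
        (u + v + 4) * (u + v + 3) * C1 * c1
    have h : (u + v + 4) * (u + v + 3) * ((u + 1) * (v + 1)) ≤
        (u + v + 2) * ((u + 2) * (v + 2)) * (u + v + 2) := by
      nlinarith [sq_nonneg (u - v), mul_nonneg hu hv,
        mul_nonneg (add_nonneg hu hv) (sq_nonneg (u - v)),
        mul_nonneg (add_nonneg hu hv) (sq_nonneg (u + v))]
    rw [e]
    linarith [mul_le_mul_of_nonneg_right h (sq_nonneg C1)]
  have k2 : 2 * (u + v + 2 - 1) * C2 ≤ (u + v + 2) * C1 := by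
    refine le_of_mul_le_mul_left ?_ (show (0 : ℝ) < u + v + 2 by linarith)
    have e : (u + v + 2) * (2 * (u + v + 2 - 1) * C2) = 2 * ((u + 1) * (v + 1)) * C1 := by
      linear_combination (-2) * c1
    have h : 2 * ((u + 1) * (v + 1)) ≤ (u + v + 2) * (u + v + 2) := by nlinarith
    rw [e]
    linarith [mul_le_mul_of_nonneg_right h p1]
  refine ⟨?_, ?_⟩
  · have m := mul_le_mul hR2 k1 (mul_nonneg (by linarith) (mul_nonneg p2 p0)) (sq_nonneg _)
    have := mul_le_mul_of_nonneg_left m (sq_nonneg c)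
    linarith
  · have m := mul_le_mul hR k2 (mul_nonneg (by linarith) p2) n1
    have := mul_le_mul_of_nonneg_left m hc
    linarith

end ColoringNumber

/-! ### Counting injections constrained by a Ferrers board -/

section Injections

open Function

variable {C : Type*} [DecidableEq C]

/-- `g` is an injection that sends row `q` to one of the colors `S q` of its board cells or to one of the
free colors `F`, and exactly `j` rows get a color that is not free. -/
def IsFerrersInjection (F : Finset C) (S : ℕ → Finset C) (p j : ℕ) (g : Fin p → C) : Prop :=
  Injective g ∧ (∀ q : Fin p, g q ∈ S q ∪ F) ∧
    (Finset.univ.filter fun q : Fin p => g q ∉ F).card = j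

variable {F : Finset C} {S : ℕ → Finset C} {p j : ℕ}

lemma isFerrersInjection_snoc (g : Fin p → C) (c : C) :
    IsFerrersInjection F S (p + 1) j (Fin.snoc g c : Fin (p + 1) → C) ↔
      (Injective g ∧ c ∉ Set.range g) ∧ ((∀ q : Fin p, g q ∈ S q ∪ F) ∧ c ∈ S p ∪ F) ∧
        (Finset.univ.filter fun q : Fin p => g q ∉ F).card + (if c ∉ F then 1 else 0) = j := by
  have hcard : (Finset.univ.filter fun q : Fin (p + 1) =>
      (Fin.snoc g c : Fin (p + 1) → C) q ∉ F).card =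
      (Finset.univ.filter fun q : Fin p => g q ∉ F).card + (if c ∉ F then 1 else 0) := by
    simp only [Finset.card_filter, Fin.sum_univ_castSucc, Fin.snoc_castSucc, Fin.snoc_last]
  rw [IsFerrersInjection, hcard, Fin.snoc_injective_iff, Fin.forall_fin_succ']
  simp

lemma isFerrersInjection_snoc_zero (g : Fin p → C) (c : C) :
    IsFerrersInjection F S (p + 1) 0 (Fin.snoc g c : Fin (p + 1) → C) ↔
      IsFerrersInjection F S p 0 g ∧ c ∈ F \ Finset.univ.image g := by
  rw [isFerrersInjection_snoc, IsFerrersInjection]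
  by_cases hc : c ∈ F
  · simp [hc]; tauto
  · simp [hc]

lemma isFerrersInjection_snoc_succ (hd : ∀ q, Disjoint (S q) F) (g : Fin p → C) (c : C) :
    IsFerrersInjection F S (p + 1) (j + 1) (Fin.snoc g c : Fin (p + 1) → C) ↔
      (IsFerrersInjection F S p (j + 1) g ∧ c ∈ F \ Finset.univ.image g) ∨
      (IsFerrersInjection F S p j g ∧ c ∈ S p \ Finset.univ.image g) := by
  rw [isFerrersInjection_snoc, IsFerrersInjection, IsFerrersInjection]
  have : c ∈ S p → c ∉ F := fun h => Finset.disjoint_left.mp (hd p) h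
  by_cases hc : c ∈ F
  · have hS : c ∉ S p := fun h => this h hc
    simp [hc, hS]; tauto
  · simp [hc]; tauto

/-- The free colors that are still unused. -/
lemma IsFerrersInjection.card_free {g : Fin p → C} (hg : IsFerrersInjection F S p j g) :
    ((F \ Finset.univ.image g).card : ℝ) = F.card - ((p : ℝ) - j) := by
  obtain ⟨h1, -, h3⟩ := hg
  have e1 := Finset.card_filter_add_card_filter_not (s := Finset.univ) (fun q : Fin p => g q ∈ F)
  have e2 : (F ∩ Finset.univ.image g).card = (Finset.univ.filter fun q : Fin p => g q ∈ F).card := by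
    rw [← Finset.card_image_of_injective _ h1]
    congr 1
    ext c
    simp only [Finset.mem_inter, Finset.mem_image, Finset.mem_univ, true_and, Finset.mem_filter]
    constructor
    · rintro ⟨hc, q, rfl⟩; exact ⟨q, hc, rfl⟩
    · rintro ⟨q, hc, rfl⟩; exact ⟨hc, q, rfl⟩
  have e3 := Finset.card_sdiff_add_card_inter F (Finset.univ.image g)
  rw [h3, Finset.card_univ, Fintype.card_fin] at e1
  rw [e2] at e3
  have e1' : ((Finset.univ.filter fun q : Fin p => g q ∈ F).card : ℝ) + j = p := by
    exact_mod_cast e1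
  have e3' : ((F \ Finset.univ.image g).card : ℝ) +
    (Finset.univ.filter fun q : Fin p => g q ∈ F).card = F.card := by exact_mod_cast e3
  linarith

/-- The colors of the new row's cells that are still unused. The non-free colors in use all lie in `S p`,
because the rows are nested. -/
lemma IsFerrersInjection.card_row (hS : Monotone S) (hd : ∀ q, Disjoint (S q) F) {g : Fin p → C}
    (hg : IsFerrersInjection F S p j g) :
    ((S p \ Finset.univ.image g).card : ℝ) = (S p).card - j := by
  obtain ⟨h1, h2, h3⟩ := hg
  have e2 : (S p ∩ Finset.univ.image g).card =
      (Finset.univ.filter fun q : Fin p => g q ∉ F).card := by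
    rw [← Finset.card_image_of_injective _ h1]
    congr 1
    ext c
    simp only [Finset.mem_inter, Finset.mem_image, Finset.mem_univ, true_and, Finset.mem_filter]
    constructor
    · rintro ⟨hc, q, rfl⟩; exact ⟨q, Finset.disjoint_left.mp (hd p) hc, rfl⟩
    · rintro ⟨q, hc, rfl⟩
      refine ⟨?_, q, rfl⟩
      exact hS q.2.le ((Finset.mem_union.mp (h2 q)).resolve_right hc)
  have e3 := Finset.card_sdiff_add_card_inter (S p) (Finset.univ.image g)
  rw [e2, h3] at e3
  have e3' : ((S p \ Finset.univ.image g).card : ℝ) + j = (S p).card := by exact_mod_cast e3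
  linarith

open Classical in
/-- The count factors into the rook number and the number of ways to give the remaining `p - j` rows
distinct free colors. -/
theorem card_isFerrersInjection [Fintype C] (hS : Monotone S) (hd : ∀ q, Disjoint (S q) F)
    {L : ℕ → ℕ} (hL : ∀ q, (S q).card = L q) (p j : ℕ) :
    ((Finset.univ.filter fun g : Fin p → C => IsFerrersInjection F S p j g).card : ℝ) =
      rookNumber L p j * (F.card.descFactorial (p - j) : ℕ) := by
  induction p generalizing j with
  | zero =>
    cases j with
    | zero =>
      rw [Finset.filter_true_of_mem, Finset.card_univ]
      · simp [rookNumber]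
      · intro g _
        exact ⟨injective_of_subsingleton g, fun q => q.elim0, by simp⟩
    | succ j =>
      rw [Finset.filter_false_of_mem]
      · simp [rookNumber]
      · rintro g _ ⟨-, -, h⟩
        simp at h
  | succ p ih =>
    have hsum : ∀ j, ((Finset.univ.filter fun g : Fin (p + 1) → C =>
        IsFerrersInjection F S (p + 1) j g).card : ℝ) =
        ∑ g : Fin p → C, ∑ c : C,
          if IsFerrersInjection F S (p + 1) j (Fin.snoc g c : Fin (p + 1) → C)
            then (1 : ℝ) else 0 := by
      intro j
      rw [Finset.card_filter, Nat.cast_sum,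
        ← (Fin.snocEquiv fun _ : Fin (p + 1) => C).sum_comp, Fintype.sum_prod_type,
        Finset.sum_comm]
      refine Finset.sum_congr rfl fun g _ => Finset.sum_congr rfl fun c _ => ?_
      rw [Nat.cast_ite, Nat.cast_one, Nat.cast_zero]
      rfl
    have hfree : ∀ j, ∑ g : Fin p → C, ∑ c : C,
        (if IsFerrersInjection F S p j g ∧ c ∈ F \ Finset.univ.image g then (1 : ℝ) else 0) =
        rookNumber L p j * (F.card.descFactorial (p - j) : ℕ) * (F.card - ((p : ℝ) - j)) := by
      intro j
      rw [← ih j, Finset.cast_card, Finset.sum_mul, Finset.sum_filter]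
      refine Finset.sum_congr rfl fun g _ => ?_
      by_cases hg : IsFerrersInjection F S p j g
      · rw [if_pos hg, one_mul, ← hg.card_free]
        simp only [hg, true_and, Finset.sum_boole, Finset.filter_mem_eq_inter, Finset.univ_inter]
      · simp [hg]
    have hrow : ∀ j, ∑ g : Fin p → C, ∑ c : C,
        (if IsFerrersInjection F S p j g ∧ c ∈ S p \ Finset.univ.image g then (1 : ℝ) else 0) =
        rookNumber L p j * (F.card.descFactorial (p - j) : ℕ) * (L p - j) := by
      intro j
      rw [← ih j, Finset.cast_card, Finset.sum_mul, Finset.sum_filter]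
      refine Finset.sum_congr rfl fun g _ => ?_
      by_cases hg : IsFerrersInjection F S p j g
      · rw [if_pos hg, one_mul, ← hL, ← hg.card_row hS hd]
        simp only [hg, true_and, Finset.sum_boole, Finset.filter_mem_eq_inter, Finset.univ_inter]
      · simp [hg]
    have hdesc : ∀ m : ℕ, ((F.card.descFactorial (m + 1) : ℕ) : ℝ) =
        (F.card.descFactorial m : ℕ) * (F.card - (m : ℝ)) := by
      intro m
      rw [Nat.descFactorial_succ]
      rcases le_or_gt m F.card with h | h
      · push_cast [Nat.cast_sub h]; ring
      · rw [Nat.descFactorial_eq_zero_iff_lt.2 h]; simp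
    rw [hsum]
    cases j with
    | zero =>
      simp only [isFerrersInjection_snoc_zero]
      rw [hfree, Nat.sub_zero, Nat.sub_zero, hdesc, rookNumber_zero_right, rookNumber_zero_right]
      push_cast
      ring
    | succ j =>
      have hsplit : ∀ (g : Fin p → C) (c : C),
          (if IsFerrersInjection F S (p + 1) (j + 1) (Fin.snoc g c : Fin (p + 1) → C)
            then (1 : ℝ) else 0) =
          (if IsFerrersInjection F S p (j + 1) g ∧ c ∈ F \ Finset.univ.image g
            then (1 : ℝ) else 0) +
          (if IsFerrersInjection F S p j g ∧ c ∈ S p \ Finset.univ.image g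
            then (1 : ℝ) else 0) := by
        intro g c
        rw [if_congr (isFerrersInjection_snoc_succ hd g c) rfl rfl]
        by_cases h1 : IsFerrersInjection F S p (j + 1) g ∧ c ∈ F \ Finset.univ.image g
        · have h2 : ¬ (IsFerrersInjection F S p j g ∧ c ∈ S p \ Finset.univ.image g) := by
            rintro ⟨h, -⟩
            have := h1.1.2.2.symm.trans h.2.2
            omega
          rw [if_pos (Or.inl h1), if_pos h1, if_neg h2, add_zero]
        · rw [if_neg h1, zero_add]
          exact if_congr (or_iff_right h1) rfl rfl
      simp only [hsplit, Finset.sum_add_distrib]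
      rw [hfree, hrow, rookNumber_succ_succ, Nat.add_sub_add_right]
      rcases lt_trichotomy p j with h | h | h
      · rw [rookNumber_eq_zero_of_lt L h, rookNumber_eq_zero_of_lt L (h.trans (Nat.lt_succ_self j))]
        ring
      · subst h
        rw [rookNumber_eq_zero_of_lt L (Nat.lt_succ_self p)]
        ring
      · obtain ⟨m, rfl⟩ := Nat.exists_eq_add_of_le h
        rw [show j.succ + m - (j + 1) = m by omega, show j.succ + m - j = m + 1 by omega, hdesc]
        push_cast
        ring

end Injections

/-! ### Proper colorings of co-bipartite graphs of Ferrers type -/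

section Colorings

open Function

/-- The co-bipartite graph of a Ferrers board: two cliques of sizes `t` (the columns) and `s` (the rows),
where row `q` and column `b` are non-adjacent iff the cell `(q, b)` is on the board, i.e. `b < L q`. -/
def ferrersGraph (L : ℕ → ℕ) (s t : ℕ) : SimpleGraph (Fin t ⊕ Fin s) where
  Adj
    | .inl b, .inl b' => b ≠ b'
    | .inr q, .inr q' => q ≠ q'
    | .inl b, .inr q => L q ≤ b
    | .inr q, .inl b => L q ≤ b
  symm := ⟨by
    rintro (b | q) (b' | q') h
    exacts [Ne.symm h, h, h, Ne.symm h]⟩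
  loopless := ⟨by
    rintro (b | q) h
    exacts [h rfl, h rfl]⟩

/-- The defining condition of proper colorings, as in `chromaticSymm`. -/
def IsProper {V : Type*} (G : SimpleGraph V) {C : Type*} (f : V → C) : Prop :=
  ∀ u v, G.Adj u v → f u ≠ f v

/-- The exponent vector of the monomial of a coloring: the sizes of the color classes. -/
noncomputable def coloringWeight {V : Type*} [Fintype V] {k : ℕ} (f : V → Fin k) : Fin k →₀ ℕ :=
  ∑ v, Finsupp.single (f v) 1

open Classical in
/-- The number of proper colorings of `G` with color class sizes `α`. -/
noncomputable def coloringCount {V : Type*} [Fintype V] [DecidableEq V] (G : SimpleGraph V) {k : ℕ}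
    (α : Fin k →₀ ℕ) : ℕ :=
  (Finset.univ.filter fun f : V → Fin k => IsProper G f ∧ coloringWeight f = α).card

section General

variable {V : Type*} [Fintype V] {k : ℕ}

lemma coloringWeight_apply [DecidableEq V] (f : V → Fin k) (i : Fin k) :
    coloringWeight f i = (Finset.univ.filter fun v => f v = i).card := by
  rw [coloringWeight, Finsupp.finsetSum_apply, Finset.card_filter]
  exact Finset.sum_congr rfl fun v _ => Finsupp.single_apply

lemma sum_coloringWeight (f : V → Fin k) : ∑ i, coloringWeight f i = Fintype.card V := by
  simp only [coloringWeight, Finsupp.finsetSum_apply]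
  rw [Finset.sum_comm]
  simp [Finsupp.single_apply]

lemma coeff_chromaticSymm [DecidableEq V] (G : SimpleGraph V) (α : Fin k →₀ ℕ) :
    (chromaticSymm G k).coeff α = coloringCount G α := by
  classical
  have h : ∀ f : V → Fin k, ∏ v, (X (f v) : MvPolynomial (Fin k) ℝ) =
      monomial (coloringWeight f) 1 := by
    intro f
    rw [coloringWeight, monomial_sum_one]
    rfl
  rw [chromaticSymm, coeff_sum, coloringCount]
  simp only [h, coeff_monomial]
  rw [← Finset.sum_filter, Finset.filter_filter, Finset.sum_const, nsmul_eq_mul, mul_one]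
  unfold IsProper
  congr

lemma coloringCount_comp_perm [DecidableEq V] (G : SimpleGraph V) {α β : Fin k →₀ ℕ}
    (σ : Equiv.Perm (Fin k)) (h : ∀ i, β (σ i) = α i) :
    coloringCount G α = coloringCount G β := by
  classical
  refine Finset.card_equiv (Equiv.arrowCongr (Equiv.refl V) σ) fun f => ?_
  have hw : ∀ i, coloringWeight (σ ∘ f) (σ i) = coloringWeight f i := by
    intro i
    simp [coloringWeight_apply]
  have hw' : coloringWeight (σ ∘ f) = β ↔ coloringWeight f = α := by
    constructor
    · rintro rfl
      ext i
      rw [← h, hw]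
    · rintro rfl
      ext i
      obtain ⟨i, rfl⟩ := σ.surjective i
      rw [h, hw]
  have hp : IsProper G (σ ∘ f) ↔ IsProper G f := by
    simp [IsProper]
  simp only [Finset.mem_filter, Finset.mem_univ, true_and]
  rw [← hp, ← hw']
  rfl

lemma chromaticSymm_eq_of_iso {W : Type*} [Fintype W] [DecidableEq V] [DecidableEq W]
    {G : SimpleGraph V} {H : SimpleGraph W} (e : G ≃g H) (k : ℕ) :
    chromaticSymm G k = chromaticSymm H k := by
  classical
  refine Finset.sum_equiv (Equiv.arrowCongr e.toEquiv (Equiv.refl (Fin k))) ?_ ?_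
  · intro f
    simp only [Finset.mem_filter, Finset.mem_univ, true_and]
    constructor
    · intro h u v huv
      exact h _ _ ((e.symm.map_rel_iff).2 huv)
    · intro h u v huv
      have := h (e u) (e v) (e.map_rel_iff.2 huv)
      change f (e.toEquiv.symm (e.toEquiv u)) ≠ f (e.toEquiv.symm (e.toEquiv v)) at this
      rwa [Equiv.symm_apply_apply, Equiv.symm_apply_apply] at this
  · intro f _
    refine Fintype.prod_equiv e.toEquiv _ _ fun v => ?_
    change X (f v) = X (f (e.toEquiv.symm (e.toEquiv v)))
    rw [Equiv.symm_apply_apply]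

end General

/-- The indices at which `α` has the entry `m`. -/
def levelSet {k : ℕ} (α : Fin k →₀ ℕ) (m : ℕ) : Finset (Fin k) :=
  Finset.univ.filter fun i => α i = m

lemma mem_levelSet {k : ℕ} {α : Fin k →₀ ℕ} {m : ℕ} {i : Fin k} : i ∈ levelSet α m ↔ α i = m := by
  simp [levelSet]

lemma two_mul_card_levelSet_add {k : ℕ} {α : Fin k →₀ ℕ} (h : ∀ i, α i ≤ 2) :
    2 * (levelSet α 2).card + (levelSet α 1).card = ∑ i, α i := by
  rw [levelSet, levelSet, Finset.card_filter, Finset.card_filter, Finset.mul_sum,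
    ← Finset.sum_add_distrib]
  refine Finset.sum_congr rfl fun i _ => ?_
  have := h i
  interval_cases α i <;> simp

lemma exists_perm_of_card_fiber_eq {ι κ : Type*} [Fintype ι] [DecidableEq ι] [DecidableEq κ]
    {α β : ι → κ}
    (h : ∀ m, (Finset.univ.filter fun i => α i = m).card =
      (Finset.univ.filter fun i => β i = m).card) :
    ∃ σ : Equiv.Perm ι, ∀ i, β (σ i) = α i := by
  have e : ∀ m, {i // α i = m} ≃ {i // β i = m} := fun m =>
    Fintype.equivOfCardEq (by rw [Fintype.card_subtype, Fintype.card_subtype, h])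
  refine ⟨(Equiv.sigmaFiberEquiv α).symm.trans
    ((Equiv.sigmaCongrRight e).trans (Equiv.sigmaFiberEquiv β)), fun i => ?_⟩
  exact (e (α i) ⟨i, rfl⟩).2

lemma coloringCount_eq_of_card_levelSet {V : Type*} [Fintype V] [DecidableEq V]
    (G : SimpleGraph V) {k : ℕ} {α β : Fin k →₀ ℕ} (hα : ∀ i, α i ≤ 2) (hβ : ∀ i, β i ≤ 2)
    (h2 : (levelSet α 2).card = (levelSet β 2).card)
    (h1 : (levelSet α 1).card = (levelSet β 1).card) : coloringCount G α = coloringCount G β := by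
  have htot : ∀ γ : Fin k →₀ ℕ, (∀ i, γ i ≤ 2) →
      (levelSet γ 0).card + (levelSet γ 1).card + (levelSet γ 2).card = k := by
    intro γ hγ
    rw [levelSet, levelSet, levelSet, Finset.card_filter, Finset.card_filter, Finset.card_filter,
      ← Finset.sum_add_distrib, ← Finset.sum_add_distrib]
    trans ∑ i : Fin k, 1
    · refine Finset.sum_congr rfl fun i _ => ?_
      have := hγ i
      interval_cases γ i <;> simp
    · simp
  have hlarge : ∀ γ : Fin k →₀ ℕ, (∀ i, γ i ≤ 2) → ∀ m, (levelSet γ (m + 3)).card = 0 := by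
    intro γ hγ m
    rw [Finset.card_eq_zero, levelSet, Finset.filter_eq_empty_iff]
    intro i _ hi
    have := hγ i
    omega
  obtain ⟨σ, hσ⟩ := exists_perm_of_card_fiber_eq (α := α) (β := β) fun m => by
    change (levelSet α m).card = (levelSet β m).card
    rcases m with _ | _ | _ | m
    · have := htot α hα
      have := htot β hβ
      omega
    · exact h1
    · exact h2
    · rw [hlarge α hα, hlarge β hβ]
  exact coloringCount_comp_perm G σ hσ

variable {L : ℕ → ℕ} {s t k : ℕ}

lemma isProper_ferrersGraph {C : Type*} {f : Fin t → C} {g : Fin s → C} :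
    IsProper (ferrersGraph L s t) (Sum.elim f g) ↔
      Injective f ∧ Injective g ∧ ∀ b q, f b = g q → (b : ℕ) < L q := by
  constructor
  · intro h
    refine ⟨fun b b' hb => ?_, fun q q' hq => ?_, fun b q hbq => ?_⟩
    · by_contra hne
      exact h (.inl b) (.inl b') hne hb
    · by_contra hne
      exact h (.inr q) (.inr q') hne hq
    · by_contra hne
      exact h (.inl b) (.inr q) (not_lt.mp hne) hbq
  · rintro ⟨h1, h2, h3⟩ (b | q) (b' | q') h he
    · exact h (h1 he)
    · exact absurd (h3 _ _ he) (not_lt.mpr h)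
    · exact absurd (h3 _ _ he.symm) (not_lt.mpr h)
    · exact h (h2 he)

lemma coloringWeight_elim_apply {f : Fin t → Fin k} {g : Fin s → Fin k} (hf : Injective f)
    (hg : Injective g) (i : Fin k) : coloringWeight (Sum.elim f g) i =
      (if i ∈ Finset.univ.image f then 1 else 0) + if i ∈ Finset.univ.image g then 1 else 0 := by
  have key : ∀ {n : ℕ} {f : Fin n → Fin k}, Injective f →
      ∑ b, (Finsupp.single (f b) 1 : Fin k →₀ ℕ) i =
        if i ∈ Finset.univ.image f then 1 else 0 := by
    intro n f hf
    rw [← Finset.sum_image (f := fun c => (Finsupp.single c 1 : Fin k →₀ ℕ) i) (g := f)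
      (fun a _ b _ h => hf h)]
    simp [Finsupp.single_apply]
  rw [coloringWeight, Finsupp.finsetSum_apply, Fintype.sum_sum_type]
  simp only [Sum.elim_inl, Sum.elim_inr]
  rw [key hf, key hg]

lemma coloringWeight_le_two {f : Fin t ⊕ Fin s → Fin k} (hf : IsProper (ferrersGraph L s t) f)
    (i : Fin k) : coloringWeight f i ≤ 2 := by
  rw [← Sum.elim_comp_inl_inr f] at hf ⊢
  obtain ⟨h1, h2, -⟩ := isProper_ferrersGraph.mp hf
  rw [coloringWeight_elim_apply h1 h2]
  split_ifs <;> omega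

lemma card_levelSet_coloringWeight {f : Fin t → Fin k} {g : Fin s → Fin k} (hf : Injective f)
    (hg : Injective g) : (levelSet (coloringWeight (Sum.elim f g)) 2).card =
      (Finset.univ.filter fun q => g q ∉ (Finset.univ.image f)ᶜ).card := by
  rw [← Finset.card_image_of_injective _ hg]
  congr 1
  ext i
  rw [mem_levelSet, coloringWeight_elim_apply hf hg]
  simp only [Finset.mem_image, Finset.mem_filter, Finset.mem_univ, true_and, Finset.mem_compl,
    not_not]
  constructor
  · intro h
    split_ifs at h with h1 h2 h2
    all_goals try omega
    obtain ⟨q, rfl⟩ := h2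
    exact ⟨q, h1, rfl⟩
  · rintro ⟨q, hq, rfl⟩
    rw [if_pos hq, if_pos ⟨q, rfl⟩]

open Classical in
/-- Colors that occur twice are those shared by the two cliques. The columns are colored injectively,
and the number of extensions to the rows does not depend on the coloring of the columns. -/
lemma card_proper_of_card_levelSet (hL : Monotone L) (ht : ∀ q, L q ≤ t) (s k j : ℕ) :
    ((Finset.univ.filter fun f : Fin t ⊕ Fin s → Fin k =>
      IsProper (ferrersGraph L s t) f ∧ (levelSet (coloringWeight f) 2).card = j).card : ℝ) =
      (k.descFactorial t : ℕ) * (rookNumber L s j * ((k - t).descFactorial (s - j) : ℕ)) := by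
  have hinner : ∀ f : Fin t → Fin k, Injective f →
      ((Finset.univ.filter fun g : Fin s → Fin k => IsProper (ferrersGraph L s t) (Sum.elim f g) ∧
        (levelSet (coloringWeight (Sum.elim f g)) 2).card = j).card : ℝ) =
      rookNumber L s j * ((k - t).descFactorial (s - j) : ℕ) := by
    intro f hf
    let S : ℕ → Finset (Fin k) := fun q => (Finset.univ.filter fun b : Fin t => (b : ℕ) < L q).image f
    have hS : Monotone S := fun q q' h => Finset.image_subset_image fun b hb => by
      simp only [Finset.mem_filter, Finset.mem_univ, true_and] at hb ⊢
      exact hb.trans_le (hL h)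
    have hd : ∀ q, Disjoint (S q) (Finset.univ.image f)ᶜ := fun q => by
      rw [disjoint_compl_right_iff]
      exact Finset.image_subset_image (Finset.subset_univ _)
    have hcard : ∀ q, (S q).card = L q := fun q => by
      rw [Finset.card_image_of_injective _ hf, Fin.card_filter_val_lt, min_eq_right (ht q)]
    have h := card_isFerrersInjection hS hd hcard s j
    rw [Finset.card_compl, Finset.card_image_of_injective _ hf, Finset.card_univ,
      Fintype.card_fin, Fintype.card_fin] at h
    rw [← h]
    congr 2
    ext g
    simp only [Finset.mem_filter, Finset.mem_univ, true_and]
    rw [isProper_ferrersGraph, IsFerrersInjection]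
    constructor
    · rintro ⟨⟨-, h2, h3⟩, h4⟩
      refine ⟨h2, fun q => ?_, (card_levelSet_coloringWeight hf h2).symm.trans h4⟩
      by_cases hq : g q ∈ Finset.univ.image f
      · obtain ⟨b, -, hb⟩ := Finset.mem_image.mp hq
        exact Finset.mem_union_left _ (Finset.mem_image.mpr ⟨b, by simpa using h3 b q hb, hb⟩)
      · exact Finset.mem_union_right _ (Finset.mem_compl.mpr hq)
    · rintro ⟨h2, h3, h4⟩
      refine ⟨⟨hf, h2, fun b q hbq => ?_⟩, (card_levelSet_coloringWeight hf h2).trans h4⟩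
      rcases Finset.mem_union.mp (h3 q) with h | h
      · obtain ⟨b', hb', he⟩ := Finset.mem_image.mp h
        rw [hf (hbq.trans he.symm)]
        simpa using hb'
      · exact absurd (Finset.mem_image.mpr ⟨b, Finset.mem_univ _, hbq⟩) (Finset.mem_compl.mp h)
  have hemb : (Finset.univ.filter fun f : Fin t → Fin k => Injective f).card =
      k.descFactorial t := by
    rw [← Fintype.card_subtype, Fintype.card_congr (Equiv.subtypeInjectiveEquivEmbedding _ _),
      Fintype.card_embedding_eq, Fintype.card_fin, Fintype.card_fin]
  rw [Finset.card_filter, Nat.cast_sum, ← (Equiv.sumArrowEquivProdArrow _ _ _).symm.sum_comp,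
    Fintype.sum_prod_type, ← hemb, Finset.cast_card, Finset.sum_mul, Finset.sum_filter]
  refine Finset.sum_congr rfl fun f _ => ?_
  by_cases hf : Injective f
  · rw [if_pos hf, one_mul, ← hinner f hf, Finset.card_filter, Nat.cast_sum]
    rfl
  · rw [if_neg hf]
    refine Finset.sum_eq_zero fun g _ => ?_
    rw [if_neg, Nat.cast_zero]
    rintro ⟨h, -⟩
    exact hf (isProper_ferrersGraph.mp h).1

lemma descFactorial_mul_eq_choose {s t k j : ℕ} (hs : j ≤ s) (h2 : 2 * j ≤ s + t) :
    k.descFactorial t * (k - t).descFactorial (s - j) =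
      k.choose j * (k - j).choose (s + t - 2 * j) * (j ! * (s + t - 2 * j)!) := by
  have e1 := Nat.descFactorial_mul_descFactorial (n := k) (show t ≤ s + t - j by omega)
  have e2 := Nat.descFactorial_mul_descFactorial (n := k) (show j ≤ s + t - j by omega)
  rw [show s + t - j - t = s - j by omega] at e1
  rw [show s + t - j - j = s + t - 2 * j by omega, Nat.descFactorial_eq_factorial_mul_choose,
    Nat.descFactorial_eq_factorial_mul_choose] at e2
  rw [mul_comm, e1, ← e2]
  ring

/-- The coefficients of the chromatic symmetric function. The colorings with `j` shared colors are
distributed evenly over the pairs of a `j`-set of colors used twice and a disjoint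
`(s + t - 2 * j)`-set of colors used once. -/
theorem coloringCount_ferrersGraph (hL : Monotone L) (ht : ∀ q, L q ≤ t) {α : Fin k →₀ ℕ}
    (hα : ∀ i, α i ≤ 2) (hsum : ∑ i, α i = s + t) :
    (coloringCount (ferrersGraph L s t) α : ℝ) =
      coloringNumber L s t (levelSet α 2).card := by
  classical
  have hcard := two_mul_card_levelSet_add hα
  rw [hsum] at hcard
  have htotal := card_proper_of_card_levelSet hL ht s k (levelSet α 2).card
  set j := (levelSet α 2).card with hj
  have ho : (levelSet α 1).card = s + t - 2 * j := by omega
  let P : Finset (Σ _ : Finset (Fin k), Finset (Fin k)) :=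
    (Finset.powersetCard j Finset.univ).sigma fun T => Finset.powersetCard (s + t - 2 * j) Tᶜ
  have hPcard : P.card = k.choose j * (k - j).choose (s + t - 2 * j) := by
    rw [Finset.card_sigma, Finset.sum_congr rfl (g := fun _ => (k - j).choose (s + t - 2 * j)),
      Finset.sum_const, Finset.card_powersetCard, Finset.card_univ, Fintype.card_fin, smul_eq_mul]
    intro T hT
    rw [Finset.card_powersetCard, Finset.card_compl, Fintype.card_fin,
      (Finset.mem_powersetCard.mp hT).2]
  have hdisj : ∀ β : Fin k →₀ ℕ, levelSet β 1 ⊆ (levelSet β 2)ᶜ := by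
    intro β i hi
    rw [Finset.mem_compl, mem_levelSet, mem_levelSet.mp hi]
    omega
  have hPpos : 0 < P.card := by
    refine Finset.card_pos.mpr ⟨⟨levelSet α 2, levelSet α 1⟩, ?_⟩
    rw [Finset.mem_sigma, Finset.mem_powersetCard, Finset.mem_powersetCard]
    exact ⟨⟨Finset.subset_univ _, rfl⟩, hdisj α, ho⟩
  have hfib : (Finset.univ.filter fun f : Fin t ⊕ Fin s → Fin k =>
      IsProper (ferrersGraph L s t) f ∧ (levelSet (coloringWeight f) 2).card = j).card =
      P.card * coloringCount (ferrersGraph L s t) α := by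
    rw [Finset.card_eq_sum_card_fiberwise (t := P)
      (f := fun f => ⟨levelSet (coloringWeight f) 2, levelSet (coloringWeight f) 1⟩)]
    · rw [← smul_eq_mul, ← Finset.sum_const]
      refine Finset.sum_congr rfl fun x hx => ?_
      obtain ⟨T, U⟩ := x
      rw [Finset.mem_sigma, Finset.mem_powersetCard, Finset.mem_powersetCard] at hx
      obtain ⟨⟨-, hT⟩, hUT, hU⟩ := hx
      dsimp only at hT hUT hU
      let β : Fin k →₀ ℕ := Finsupp.equivFunOnFinite.symm
        fun i => if i ∈ T then 2 else if i ∈ U then 1 else 0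
      have hβ : ∀ i, β i = if i ∈ T then 2 else if i ∈ U then 1 else 0 := fun i => rfl
      have hβ2 : levelSet β 2 = T := by
        ext i
        rw [mem_levelSet, hβ]
        split_ifs with h1 h2 <;> simp [h1]
      have hβ1 : levelSet β 1 = U := by
        ext i
        rw [mem_levelSet, hβ]
        split_ifs with h1 h2
        · simpa using fun h : i ∈ U => Finset.mem_compl.mp (hUT h) h1
        · simp [h2]
        · simp [h2]
      have hβle : ∀ i, β i ≤ 2 := fun i => by
        rw [hβ]
        split_ifs <;> omega
      rw [coloringCount_eq_of_card_levelSet (ferrersGraph L s t) hα hβle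
        (by rw [hβ2, hT]) (by rw [hβ1, hU, ho]), coloringCount, Finset.filter_filter]
      congr 1
      ext f
      simp only [Finset.mem_filter, Finset.mem_univ, true_and, Sigma.mk.injEq, heq_eq_eq]
      constructor
      · rintro ⟨⟨h1, -⟩, h3, h4⟩
        refine ⟨h1, Finsupp.ext fun i => ?_⟩
        have hle := coloringWeight_le_two h1 i
        have e2 := mem_levelSet (α := coloringWeight f) (m := 2) (i := i)
        have e1 := mem_levelSet (α := coloringWeight f) (m := 1) (i := i)
        rw [h3] at e2
        rw [h4] at e1
        rw [hβ]
        split_ifs with h5 h6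
        · exact e2.mp h5
        · exact e1.mp h6
        · rw [e2] at h5
          rw [e1] at h6
          omega
      · rintro ⟨h1, h2⟩
        rw [h2, hβ2, hβ1]
        exact ⟨⟨h1, hT⟩, rfl, rfl⟩
    · intro f hf
      simp only [Finset.coe_filter, Finset.mem_univ, true_and, Set.mem_ofPred_eq] at hf
      obtain ⟨h1, h2⟩ := hf
      have := two_mul_card_levelSet_add (coloringWeight_le_two h1)
      rw [sum_coloringWeight, Fintype.card_sum, Fintype.card_fin, Fintype.card_fin] at this
      rw [Finset.mem_coe, Finset.mem_sigma, Finset.mem_powersetCard, Finset.mem_powersetCard]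
      exact ⟨⟨Finset.subset_univ _, h2⟩, hdisj _, by dsimp only; omega⟩
  rw [hfib] at htotal
  have hP0 : (P.card : ℝ) ≠ 0 := by exact_mod_cast hPpos.ne'
  refine mul_left_cancel₀ hP0 ?_
  rw [Nat.cast_mul] at htotal
  rw [htotal, coloringNumber]
  rcases le_or_gt j s with hjs | hjs
  · have e := congrArg (Nat.cast (R := ℝ))
      (descFactorial_mul_eq_choose (k := k) (t := t) hjs (by omega))
    rw [← hPcard] at e
    push_cast at e
    linear_combination rookNumber L s j * e
  · rw [rookNumber_eq_zero_of_lt L hjs]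
    ring

lemma coloringCount_ferrersGraph_eq_zero {α : Fin k →₀ ℕ}
    (h : ¬((∀ i, α i ≤ 2) ∧ ∑ i, α i = s + t)) : coloringCount (ferrersGraph L s t) α = 0 := by
  classical
  rw [coloringCount, Finset.card_eq_zero, Finset.filter_eq_empty_iff]
  rintro f - ⟨h1, rfl⟩
  refine h ⟨coloringWeight_le_two h1, ?_⟩
  rw [sum_coloringWeight, Fintype.card_sum, Fintype.card_fin, Fintype.card_fin, add_comm]

end Colorings

/-! ### M-convexity of the support -/

section MConvex

variable {k : ℕ}

/-- The exchange move `α - e_i + e_j` of M-convexity, for `0 < α i`. -/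
noncomputable def exchange (α : Fin k →₀ ℕ) (i j : Fin k) : Fin k →₀ ℕ :=
  α - Finsupp.single i 1 + Finsupp.single j 1

lemma exchange_apply {α : Fin k →₀ ℕ} {i j : Fin k} (hij : i ≠ j) (x : Fin k) :
    exchange α i j x = if x = i then α x - 1 else if x = j then α x + 1 else α x := by
  rw [exchange, Finsupp.add_apply, Finsupp.tsub_apply, Finsupp.single_apply, Finsupp.single_apply]
  split_ifs with h1 h2 h3 h4 h5 h6 <;> omega

lemma sum_exchange {α : Fin k →₀ ℕ} {i j : Fin k} (hij : i ≠ j) (hi : 0 < α i) :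
    ∑ x, exchange α i j x = ∑ x, α x := by
  have h : ∀ x, exchange α i j x + (if x = i then 1 else 0) = α x + (if x = j then 1 else 0) := by
    intro x
    rw [exchange_apply hij]
    split_ifs with h1 h2 h2
    · exact absurd (h1.symm.trans h2) hij
    · subst h1; omega
    · rfl
    · rfl
  have := Finset.sum_congr (rfl : (Finset.univ : Finset (Fin k)) = _) fun x _ => h x
  rw [Finset.sum_add_distrib, Finset.sum_add_distrib, Finset.sum_ite_eq', Finset.sum_ite_eq'] at this
  simpa using this

lemma card_levelSet_exchange {α : Fin k →₀ ℕ} {i j : Fin k} (hij : i ≠ j) (hi : α i ≤ 2)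
    (hj : α j < 2) : (levelSet (exchange α i j) 2).card + (if α i = 2 then 1 else 0) =
      (levelSet α 2).card + (if α j = 1 then 1 else 0) := by
  have h : ∀ x, (if exchange α i j x = 2 then 1 else 0) +
      (if x = i then (if α i = 2 then 1 else 0) else 0) =
      (if α x = 2 then 1 else 0) + (if x = j then (if α j = 1 then 1 else 0) else 0) := by
    intro x
    rw [exchange_apply hij]
    by_cases h1 : x = i
    · subst h1
      rw [if_pos rfl, if_pos rfl, if_neg hij, if_neg (by omega)]
      omega
    · rw [if_neg h1, if_neg h1]
      by_cases h2 : x = j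
      · subst h2
        rw [if_pos rfl, if_pos rfl, if_neg (show α x ≠ 2 by omega)]
        simp
      · rw [if_neg h2, if_neg h2]
  have := Finset.sum_congr (rfl : (Finset.univ : Finset (Fin k)) = _) fun x _ => h x
  rw [Finset.sum_add_distrib, Finset.sum_add_distrib, Finset.sum_ite_eq', Finset.sum_ite_eq'] at this
  rw [if_pos (Finset.mem_univ i), if_pos (Finset.mem_univ j), ← Finset.card_filter,
    ← Finset.card_filter] at this
  exact this

lemma exists_lt_of_sum_eq {α β : Fin k →₀ ℕ} (h : ∑ x, α x = ∑ x, β x) {i : Fin k}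
    (hi : β i < α i) : ∃ j, α j < β j := by
  by_contra! hc
  exact absurd h (Finset.sum_lt_sum (fun x _ => hc x) ⟨i, Finset.mem_univ i, hi⟩).ne'

/-- An exchange increases the number of entries `2` only if it raises an entry `1` while lowering an
entry `1`. If this happened at the maximal number of entries `2` for every admissible `j`, comparing
the sums or the numbers of entries `2` of `α` and `β` would give a contradiction. -/
theorem isMConvex_boundedLevel (n m : ℕ) :
    IsMConvex {α : Fin k →₀ ℕ | (∀ i, α i ≤ 2) ∧ ∑ i, α i = n ∧ (levelSet α 2).card ≤ m} := by
  rintro α ⟨hα, hαn, hαm⟩ β ⟨hβ, hβn, hβm⟩ i hi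
  have hi0 : 0 < α i := by omega
  obtain ⟨j, hj, h1, h2⟩ : ∃ j, α j < β j ∧
      (levelSet (exchange α i j) 2).card ≤ m ∧ (levelSet (exchange β j i) 2).card ≤ m := by
    suffices h : ∃ j, α j < β j ∧
        (α i = 1 → α j = 1 → (levelSet α 2).card < m) ∧
        (β i = 1 → β j = 1 → (levelSet β 2).card < m) by
      obtain ⟨j, hj, h1, h2⟩ := h
      have hij : i ≠ j := by rintro rfl; omega
      have hαi := hα i
      have hβj := hβ j
      have e1 := card_levelSet_exchange hij hαi (by omega)
      have e2 := card_levelSet_exchange hij.symm hβj (by omega)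
      refine ⟨j, hj, ?_, ?_⟩
      · split_ifs at e1 <;> omega
      · split_ifs at e2 <;> omega
    by_contra! hc
    obtain ⟨j₀, hj₀⟩ := exists_lt_of_sum_eq (hαn.trans hβn.symm) hi
    have hαi := hα i
    rcases (show (α i = 1 ∧ β i = 0) ∨ (α i = 2 ∧ β i = 0) ∨ (α i = 2 ∧ β i = 1) by omega) with
      ⟨ha, hb⟩ | ⟨ha, hb⟩ | ⟨ha, hb⟩
    · have hbad : ∀ j, α j < β j → α j = 1 ∧ m ≤ (levelSet α 2).card := by
        intro j hj
        by_contra hn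
        have := hc j hj (by omega)
        omega
      have hlt : ∑ x, (β x + if α x = 2 then 1 else 0) < ∑ x, (α x + if β x = 2 then 1 else 0) := by
        refine Finset.sum_lt_sum (fun x _ => ?_) ⟨i, Finset.mem_univ i, ?_⟩
        · have h1 := hα x
          have h2 := hβ x
          have h3 := hbad x
          split_ifs <;> omega
        · simp [ha, hb]
      rw [Finset.sum_add_distrib, Finset.sum_add_distrib, ← Finset.card_filter,
        ← Finset.card_filter] at hlt
      have := (hbad j₀ hj₀).2
      rw [levelSet] at *
      omega
    · have := hc j₀ hj₀ (by omega)
      omega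
    · have hbad : ∀ j, α j < β j → β j = 1 ∧ m ≤ (levelSet β 2).card := by
        intro j hj
        by_contra hn
        have := hc j hj (by omega)
        omega
      have hlt : (levelSet β 2).card < (levelSet α 2).card := by
        refine Finset.card_lt_card ((Finset.ssubset_iff_of_subset fun x hx => ?_).mpr
          ⟨i, mem_levelSet.mpr ha, fun h => by rw [mem_levelSet] at h; omega⟩)
        rw [mem_levelSet] at hx ⊢
        have h1 := hα x
        have h3 := hbad x
        omega
      have := (hbad j₀ hj₀).2
      omega
  have hij : i ≠ j := by rintro rfl; omega
  refine ⟨j, hj, ⟨fun x => ?_, ?_, h1⟩, ⟨fun x => ?_, ?_, h2⟩⟩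
  · change exchange α i j x ≤ 2
    rw [exchange_apply hij]
    have := hα x
    have := hβ x
    split_ifs with h3 h4
    · omega
    · subst h4; omega
    · omega
  · exact (sum_exchange hij hi0).trans hαn
  · change exchange β j i x ≤ 2
    rw [exchange_apply hij.symm]
    have := hα x
    have := hβ x
    split_ifs with h3 h4
    · omega
    · subst h4; omega
    · omega
  · exact (sum_exchange hij.symm (by omega)).trans hβn

end MConvex

/-! ### A criterion for at most one positive eigenvalue -/

section Eigenvalues

open Matrix

variable {k : ℕ}

/-- A symmetric matrix that is negative semidefinite on a hyperplane has at most one positive eigenvalue: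
the span of two eigenvectors with positive eigenvalues would meet the hyperplane. For `w = 0`, the
form is nonpositive everywhere. -/
theorem atMostOnePosEigenvalue_of_hyperplane {H : Matrix (Fin k) (Fin k) ℝ} (hH : H.IsSymm)
    (w : Fin k → ℝ) (h : ∀ x : Fin k → ℝ, w ⬝ᵥ x = 0 → x ⬝ᵥ H *ᵥ x ≤ 0) :
    AtMostOnePosEigenvalue H := by
  have hH' : H.IsHermitian := by
    rw [Matrix.IsHermitian, Matrix.conjTranspose_eq_transpose_of_trivial]
    exact hH
  rw [AtMostOnePosEigenvalue, hH'.roots_charpoly_eq_eigenvalues]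
  rw [Multiset.filter_map, Multiset.card_map]
  change (Finset.univ.filter fun i => 0 < hH'.eigenvalues i).card ≤ 1
  rw [Finset.card_le_one]
  intro a ha b hb
  by_contra hab
  simp only [Finset.mem_filter, Finset.mem_univ, true_and] at ha hb
  let u : Fin k → ℝ := hH'.eigenvectorBasis a
  let v : Fin k → ℝ := hH'.eigenvectorBasis b
  have hu : H *ᵥ u = hH'.eigenvalues a • u := hH'.mulVec_eigenvectorBasis a
  have hv : H *ᵥ v = hH'.eigenvalues b • v := hH'.mulVec_eigenvectorBasis b
  have horth : ∀ i j, (hH'.eigenvectorBasis i : Fin k → ℝ) ⬝ᵥ (hH'.eigenvectorBasis j : Fin k → ℝ) =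
      if i = j then 1 else 0 := by
    intro i j
    rw [← (orthonormal_iff_ite.mp hH'.eigenvectorBasis.orthonormal i j), EuclideanSpace.inner_eq_star_dotProduct, dotProduct_comm]
    simp
  have huu : u ⬝ᵥ u = 1 := by simpa using horth a a
  have hvv : v ⬝ᵥ v = 1 := by simpa using horth b b
  have huv : u ⬝ᵥ v = 0 := by simpa [hab] using horth a b
  have hvu : v ⬝ᵥ u = 0 := by rw [dotProduct_comm]; exact huv
  obtain ⟨c, d, hcd, hw⟩ : ∃ c d : ℝ, (c ≠ 0 ∨ d ≠ 0) ∧ c * (w ⬝ᵥ u) + d * (w ⬝ᵥ v) = 0 := by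
    by_cases h0 : w ⬝ᵥ u = 0
    · exact ⟨1, 0, Or.inl one_ne_zero, by simp [h0]⟩
    · exact ⟨-(w ⬝ᵥ v), w ⬝ᵥ u, Or.inr h0, by ring⟩
  have := h (c • u + d • v) (by simpa [dotProduct_add, dotProduct_smul] using hw)
  simp only [mulVec_add, mulVec_smul, hu, hv, dotProduct_add, add_dotProduct, dotProduct_smul,
    smul_dotProduct, huu, hvv, huv, hvu, smul_eq_mul] at this
  rcases hcd with hc | hd
  · nlinarith [mul_pos ha (sq_pos_of_ne_zero hc), mul_nonneg hb.le (sq_nonneg d)]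
  · nlinarith [mul_pos hb (sq_pos_of_ne_zero hd), mul_nonneg ha.le (sq_nonneg c)]

/-- A binary quadratic form of nonpositive determinant and `R ≥ 0` is nonpositive on some line. -/
lemma exists_line_nonpos {P Q R : ℝ} (hR : 0 ≤ R) (h : P * R ≤ Q ^ 2) :
    ∃ c d : ℝ, ∀ x y : ℝ, c * x + d * y = 0 →
      P * x ^ 2 + 2 * Q * x * y + R * y ^ 2 ≤ 0 := by
  rcases hR.eq_or_lt with rfl | hR
  · refine ⟨1, 0, fun x y hxy => ?_⟩
    have : x = 0 := by linarith
    simp [this]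
  · refine ⟨Q, R, fun x y hxy => ?_⟩
    refine nonpos_of_mul_nonpos_right ?_ hR
    have : R * (P * x ^ 2 + 2 * Q * x * y + R * y ^ 2) =
      (Q * x + R * y) ^ 2 + (P * R - Q ^ 2) * x ^ 2 := by ring
    rw [this, hxy]
    nlinarith [sq_nonneg x]

end Eigenvalues

/-! ### Iterated derivatives and coefficients -/

section Derivatives

variable {k : ℕ}

lemma toFinsupp_cons (i : Fin k) (l : List (Fin k)) :
    Multiset.toFinsupp (↑(i :: l) : Multiset (Fin k)) =
      Multiset.toFinsupp (l : Multiset (Fin k)) + Finsupp.single i 1 := by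
  rw [← Multiset.cons_coe, ← Multiset.singleton_add, map_add, Multiset.toFinsupp_singleton,
    add_comm]

/-- Taylor coefficients: the derivative along `l` at the origin is the coefficient at the multiplicity
vector of `l`, times the product of its factorials. -/
lemma constantCoeff_iteratedPderiv (l : List (Fin k)) (f : MvPolynomial (Fin k) ℝ) :
    constantCoeff (iteratedPderiv l f) =
      coeff (Multiset.toFinsupp (l : Multiset (Fin k))) f *
        ∏ i, ((Multiset.toFinsupp (l : Multiset (Fin k)) i)! : ℝ) := by
  induction l using List.reverseRecOn generalizing f with
  | nil => simp [iteratedPderiv, constantCoeff_eq]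
  | append_singleton l i ih =>
    have h : iteratedPderiv (l ++ [i]) f = iteratedPderiv l (pderiv i f) := by
      simp [iteratedPderiv]
    have h2 : Multiset.toFinsupp (↑(l ++ [i]) : Multiset (Fin k)) =
        Multiset.toFinsupp (l : Multiset (Fin k)) + Finsupp.single i 1 := by
      rw [← toFinsupp_cons]
      congr 1
      rw [Multiset.coe_eq_coe]
      exact List.perm_append_singleton i l
    rw [h, ih, h2, coeff_pderiv, mul_assoc]
    congr 1
    rw [← Finset.mul_prod_erase _ _ (Finset.mem_univ i), ← Finset.mul_prod_erase _ _ (Finset.mem_univ i),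
      ← mul_assoc]
    congr 1
    · rw [Finsupp.add_apply, Finsupp.single_eq_same, Nat.factorial_succ]
      push_cast
      rfl
    · refine Finset.prod_congr rfl fun x hx => ?_
      rw [Finsupp.add_apply, Finsupp.single_eq_of_ne (Finset.ne_of_mem_erase hx), add_zero]

lemma quadraticHessian_iteratedPderiv (l : List (Fin k)) (f : MvPolynomial (Fin k) ℝ)
    (r s : Fin k) : quadraticHessian (iteratedPderiv l f) r s =
      coeff (Multiset.toFinsupp (l : Multiset (Fin k)) + Finsupp.single s 1 +
        Finsupp.single r 1) f *
        ∏ i, ((Multiset.toFinsupp (l : Multiset (Fin k)) + Finsupp.single s 1 +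
          Finsupp.single r 1 : Fin k →₀ ℕ) i)! := by
  have h := constantCoeff_iteratedPderiv (r :: s :: l) f
  rw [toFinsupp_cons, toFinsupp_cons] at h
  exact_mod_cast h

lemma prod_factorial_eq_two_pow {γ : Fin k →₀ ℕ} (h : ∀ i, γ i ≤ 2) :
    ∏ i, (γ i)! = 2 ^ (levelSet γ 2).card := by
  rw [levelSet, Finset.card_filter, ← Finset.prod_pow_eq_pow_sum]
  refine Finset.prod_congr rfl fun i _ => ?_
  have := h i
  interval_cases γ i <;> simp

end Derivatives

/-! ### The quadratic forms that occur -/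

section QuadraticForm

/-- The quadratic form of the Hessian in terms of the sums `B`, `C` of the entries of a vector over the
variables with `μ i = 1` and `μ i = 0`, and of the sums `U`, `V` of their squares, is nonpositive
on the kernel of a linear functional of `B` and `C`. -/
lemma exists_functional_nonpos {w₀ w₁ w₂ : ℝ} (nb nc : ℕ) (h₁ : 0 ≤ w₁) (h₂ : 0 ≤ w₂)
    (h01 : 2 * w₁ ≤ w₀) (hN : ((nb : ℝ) - 1) * (w₂ * w₀) ≤ nb * w₁ ^ 2)
    (h12 : 2 * ((nb : ℝ) - 1) * w₂ ≤ nb * w₁) :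
    ∃ c d : ℝ, ∀ B C U V : ℝ, B ^ 2 ≤ nb * U → C ^ 2 ≤ nc * V → 0 ≤ U → 0 ≤ V →
      c * B + d * C = 0 →
      4 * w₂ * (B ^ 2 - U) + 4 * w₁ * (B * C) + w₀ * C ^ 2 - (w₀ - 2 * w₁) * V ≤ 0 := by
  have hV : ∀ V : ℝ, 0 ≤ V → 0 ≤ (w₀ - 2 * w₁) * V := fun V hV => mul_nonneg (by linarith) hV
  rcases Nat.eq_zero_or_pos nb with rfl | hb
  · refine ⟨0, 1, fun B C U V hB _ hU hV' h => ?_⟩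
    have hC : C = 0 := by linarith
    have hB0 : B = 0 := by
      have : B ^ 2 ≤ 0 := by simpa using hB
      exact pow_eq_zero_iff two_ne_zero |>.mp (le_antisymm this (sq_nonneg B))
    rw [hC, hB0]
    nlinarith [hV V hV', mul_nonneg h₂ hU]
  rcases Nat.eq_zero_or_pos nc with rfl | hc
  · refine ⟨1, 0, fun B C U V _ hC hU hV' h => ?_⟩
    have hB : B = 0 := by linarith
    have hC0 : C = 0 := by
      have : C ^ 2 ≤ 0 := by simpa using hC
      exact pow_eq_zero_iff two_ne_zero |>.mp (le_antisymm this (sq_nonneg C))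
    rw [hB, hC0]
    nlinarith [hV V hV', mul_nonneg h₂ hU]
  -- Replacing `U` and `V` by their Cauchy-Schwarz bounds leaves a binary quadratic form in `B` and `C`.
  have hb1 : (1 : ℝ) ≤ nb := by exact_mod_cast hb
  have hc1 : (1 : ℝ) ≤ nc := by exact_mod_cast hc
  have hR : 0 ≤ (w₀ * (nc - 1) + 2 * w₁) / nc :=
    div_nonneg (add_nonneg (mul_nonneg (by linarith) (by linarith)) (by linarith)) (by linarith)
  obtain ⟨c, d, h⟩ := exists_line_nonpos (P := 4 * w₂ * (nb - 1) / nb) (Q := 2 * w₁) hR (by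
    rw [div_mul_div_comm, div_le_iff₀ (by positivity)]
    have e1 := mul_le_mul_of_nonneg_left hN (show (0 : ℝ) ≤ nc - 1 by linarith)
    have e2 := mul_le_mul_of_nonneg_left h12 h₁
    nlinarith)
  refine ⟨c, d, fun B C U V hB hC hU hV' hl => ?_⟩
  have h' := h B C hl
  have e1 : 4 * w₂ * (B ^ 2 - U) ≤ 4 * w₂ * (nb - 1) / nb * B ^ 2 := by
    have : B ^ 2 - U ≤ (nb - 1) / nb * B ^ 2 := by
      rw [div_mul_eq_mul_div, le_div_iff₀ (by linarith)]
      nlinarith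
    calc _ ≤ 4 * w₂ * ((nb - 1) / nb * B ^ 2) := mul_le_mul_of_nonneg_left this (by linarith)
      _ = _ := by ring
  have e2 : w₀ * C ^ 2 - (w₀ - 2 * w₁) * V ≤ (w₀ * (nc - 1) + 2 * w₁) / nc * C ^ 2 := by
    rw [div_mul_eq_mul_div, le_div_iff₀ (by linarith)]
    have := mul_le_mul_of_nonneg_left hC (show 0 ≤ w₀ - 2 * w₁ by linarith)
    nlinarith
  linarith

end QuadraticForm

/-! ### The Lorentzian property for Ferrers boards -/

section Lorentzian

open Matrix

variable {L : ℕ → ℕ} {s t k : ℕ}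

lemma coeff_chromaticSymm_ferrersGraph (hL : Monotone L) (ht : ∀ q, L q ≤ t) (α : Fin k →₀ ℕ)
    [Decidable ((∀ i, α i ≤ 2) ∧ ∑ i, α i = s + t)] :
    (chromaticSymm (ferrersGraph L s t) k).coeff α =
      if (∀ i, α i ≤ 2) ∧ ∑ i, α i = s + t then coloringNumber L s t (levelSet α 2).card else 0 := by
  rw [coeff_chromaticSymm]
  split_ifs with h
  · exact coloringCount_ferrersGraph hL ht h.1 h.2
  · rw [coloringCount_ferrersGraph_eq_zero h, Nat.cast_zero]

/-- The coefficient of the chromatic symmetric function at `γ`, for `γ` of the right degree, times the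
product of the factorials of `γ`, which is `2` to the number of entries `2`. -/
noncomputable def hessianEntry (L : ℕ → ℕ) (s t : ℕ) (γ : Fin k →₀ ℕ) : ℝ :=
  if ∀ i, γ i ≤ 2 then 2 ^ (levelSet γ 2).card * coloringNumber L s t (levelSet γ 2).card else 0

lemma hessian_chromaticSymm_ferrersGraph (hL : Monotone L) (ht : ∀ q, L q ≤ t)
    {l : List (Fin k)} (hl : l.length + 2 = s + t) (r c : Fin k) :
    quadraticHessian (iteratedPderiv l (chromaticSymm (ferrersGraph L s t) k)) r c =
      hessianEntry L s t (Multiset.toFinsupp (l : Multiset (Fin k)) + Finsupp.single c 1 +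
        Finsupp.single r 1) := by
  classical
  have hsum : ∑ i, (Multiset.toFinsupp (l : Multiset (Fin k)) + Finsupp.single c 1 +
      Finsupp.single r 1 : Fin k →₀ ℕ) i = s + t := by
    rw [← toFinsupp_cons, ← toFinsupp_cons, ← hl]
    simp only [Multiset.toFinsupp_apply]
    rw [Multiset.sum_count_eq_card (fun _ _ => Finset.mem_univ _)]
    rfl
  rw [quadraticHessian_iteratedPderiv, coeff_chromaticSymm_ferrersGraph hL ht, hessianEntry]
  by_cases h : ∀ i, (Multiset.toFinsupp (l : Multiset (Fin k)) + Finsupp.single c 1 +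
      Finsupp.single r 1 : Fin k →₀ ℕ) i ≤ 2
  · rw [if_pos ⟨h, hsum⟩, if_pos h, prod_factorial_eq_two_pow h, mul_comm]
    push_cast
    rfl
  · rw [if_neg fun h' => h h'.1, if_neg h, zero_mul]

lemma card_levelSet_add_single {γ : Fin k →₀ ℕ} {i : Fin k} (hi : γ i < 2) :
    (levelSet (γ + Finsupp.single i 1) 2).card =
      (levelSet γ 2).card + if γ i = 1 then 1 else 0 := by
  have h : ∀ x, (if (γ + Finsupp.single i 1 : Fin k →₀ ℕ) x = 2 then 1 else 0) =
      (if γ x = 2 then 1 else 0) + (if x = i then (if γ i = 1 then 1 else 0) else 0) := by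
    intro x
    rw [Finsupp.add_apply, Finsupp.single_apply]
    by_cases hx : x = i
    · subst hx
      rw [if_pos rfl, if_pos rfl]
      split_ifs <;> omega
    · rw [if_neg (Ne.symm hx), if_neg hx]
      rfl
  rw [levelSet, levelSet, Finset.card_filter, Finset.card_filter, Finset.sum_congr rfl fun x _ => h x,
    Finset.sum_add_distrib, Finset.sum_ite_eq', if_pos (Finset.mem_univ i)]

/-- The Hessian is, up to a scalar, constant on the blocks given by the entries `1` and `0` of `μ`, with
a diagonal correction on each block; rows with `μ r = 2` vanish. -/
lemma hessianEntry_eq {μ : Fin k →₀ ℕ} (hμ : ∀ i, μ i ≤ 2) (r c : Fin k) :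
    hessianEntry L s t (μ + Finsupp.single c 1 + Finsupp.single r 1) =
      2 ^ (levelSet μ 2).card *
        (4 * coloringNumber L s t ((levelSet μ 2).card + 2) *
            ((if μ r = 1 then 1 else 0) * (if μ c = 1 then 1 else 0)) +
          2 * coloringNumber L s t ((levelSet μ 2).card + 1) *
            ((if μ r = 1 then 1 else 0) * (if μ c = 0 then 1 else 0) +
              (if μ r = 0 then 1 else 0) * (if μ c = 1 then 1 else 0)) +
          coloringNumber L s t (levelSet μ 2).card *
            ((if μ r = 0 then 1 else 0) * (if μ c = 0 then 1 else 0)) -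
          if r = c then 4 * coloringNumber L s t ((levelSet μ 2).card + 2) *
              (if μ r = 1 then 1 else 0) +
            (coloringNumber L s t (levelSet μ 2).card -
              2 * coloringNumber L s t ((levelSet μ 2).card + 1)) *
              (if μ r = 0 then 1 else 0) else 0) := by
  have hbad : ∀ x, 2 < (μ + Finsupp.single c 1 + Finsupp.single r 1 : Fin k →₀ ℕ) x →
      hessianEntry L s t (μ + Finsupp.single c 1 + Finsupp.single r 1) = 0 := fun x hx =>
    if_neg fun h => absurd (h x) (not_le.mpr hx)
  have hle : (∀ x, (μ + Finsupp.single c 1 + Finsupp.single r 1 : Fin k →₀ ℕ) x ≤ 2) →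
      hessianEntry L s t (μ + Finsupp.single c 1 + Finsupp.single r 1) =
      2 ^ (levelSet (μ + Finsupp.single c 1 + Finsupp.single r 1) 2).card *
        coloringNumber L s t (levelSet (μ + Finsupp.single c 1 + Finsupp.single r 1) 2).card :=
    fun h => if_pos h
  have happ : ∀ x, (μ + Finsupp.single c 1 + Finsupp.single r 1 : Fin k →₀ ℕ) x =
      μ x + (if x = c then 1 else 0) + (if x = r then 1 else 0) := by
    intro x
    rw [Finsupp.add_apply, Finsupp.add_apply, Finsupp.single_apply, Finsupp.single_apply,
      if_congr (eq_comm (a := c)) rfl rfl, if_congr (eq_comm (a := r)) rfl rfl]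
  have hr := hμ r
  have hc := hμ c
  by_cases hrc : r = c
  · subst hrc
    rcases (show μ r = 0 ∨ 1 ≤ μ r by omega) with h0 | h1
    · rw [hle, card_levelSet_add_single, card_levelSet_add_single (by omega), Finsupp.add_apply,
        Finsupp.single_eq_same, h0]
      · norm_num
        ring
      · rw [Finsupp.add_apply, Finsupp.single_eq_same]; omega
      · intro x
        rw [happ]
        have := hμ x
        split_ifs with hx
        · subst hx; omega
        · omega
    · rw [hbad r (by rw [happ]; simp; omega)]
      rcases (show μ r = 1 ∨ μ r = 2 by omega) with h | h <;> simp [h]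
  · have hcr : c ≠ r := fun h => hrc h.symm
    rw [if_neg hrc]
    by_cases h2 : μ r = 2
    · rw [hbad r (by rw [happ]; simp [hrc]; omega)]
      simp [h2]
    by_cases h2' : μ c = 2
    · rw [hbad c (by rw [happ]; simp [hcr]; omega)]
      simp [h2']
    rw [hle, card_levelSet_add_single, card_levelSet_add_single (by omega), Finsupp.add_apply,
      Finsupp.single_eq_of_ne hrc, add_zero]
    · rcases (show μ r = 0 ∨ μ r = 1 by omega) with h | h <;>
        rcases (show μ c = 0 ∨ μ c = 1 by omega) with h' | h' <;> simp [h, h'] <;> ring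
    · rw [Finsupp.add_apply, Finsupp.single_eq_of_ne hrc]; omega
    · intro x
      rw [happ]
      have := hμ x
      split_ifs with hx hx' hx'
      · exact absurd (hx.symm.trans hx') hcr
      · subst hx; omega
      · subst hx'; omega
      · omega

lemma sum_levelSet_sq_le (μ : Fin k →₀ ℕ) (m : ℕ) (x : Fin k → ℝ) :
    (∑ r, (if μ r = m then (1 : ℝ) else 0) * x r) ^ 2 ≤
      (levelSet μ m).card * ∑ r, (if μ r = m then (1 : ℝ) else 0) * x r ^ 2 := by
  have h := Finset.sum_mul_sq_le_sq_mul_sq Finset.univ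
    (fun r => if μ r = m then (1 : ℝ) else 0) (fun r => (if μ r = m then (1 : ℝ) else 0) * x r)
  have h1 : ∀ r, (if μ r = m then (1 : ℝ) else 0) * ((if μ r = m then (1 : ℝ) else 0) * x r) =
      (if μ r = m then (1 : ℝ) else 0) * x r := fun r => by split_ifs <;> ring
  have h2 : ∀ r, ((if μ r = m then (1 : ℝ) else 0) * x r) ^ 2 =
      (if μ r = m then (1 : ℝ) else 0) * x r ^ 2 := fun r => by split_ifs <;> ring
  have h3 : ∑ r, (if μ r = m then (1 : ℝ) else 0) ^ 2 = (levelSet μ m).card := by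
    rw [levelSet, Finset.cast_card, Finset.sum_filter]
    exact Finset.sum_congr rfl fun r _ => by split_ifs <;> ring
  rwa [Finset.sum_congr rfl fun r _ => h1 r, Finset.sum_congr rfl fun r _ => h2 r, h3] at h

lemma bilinear_sum {w₀ w₁ w₂ z : ℝ} (b c x : Fin k → ℝ) (H : Matrix (Fin k) (Fin k) ℝ)
    (hH : ∀ r s, H r s = z * (4 * w₂ * (b r * b s) + 2 * w₁ * (b r * c s + c r * b s) +
      w₀ * (c r * c s) - if r = s then 4 * w₂ * b r + (w₀ - 2 * w₁) * c r else 0)) :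
    x ⬝ᵥ H *ᵥ x = z * (4 * w₂ * ((∑ r, b r * x r) ^ 2 - ∑ r, b r * x r ^ 2) +
      4 * w₁ * ((∑ r, b r * x r) * (∑ r, c r * x r)) + w₀ * (∑ r, c r * x r) ^ 2 -
      (w₀ - 2 * w₁) * ∑ r, c r * x r ^ 2) := by
  have hrow : ∀ r, x r * (H *ᵥ x) r = z * (4 * w₂ * (∑ s, b s * x s) * (b r * x r) +
      2 * w₁ * ((∑ s, c s * x s) * (b r * x r) + (∑ s, b s * x s) * (c r * x r)) +
      w₀ * (∑ s, c s * x s) * (c r * x r) - 4 * w₂ * (b r * x r ^ 2) -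
      (w₀ - 2 * w₁) * (c r * x r ^ 2)) := by
    intro r
    have : (H *ᵥ x) r = ∑ s, (z * (4 * w₂ * b r + 2 * w₁ * c r) * (b s * x s) +
        z * (2 * w₁ * b r + w₀ * c r) * (c s * x s) -
        if r = s then z * (4 * w₂ * b r + (w₀ - 2 * w₁) * c r) * x s else 0) := by
      rw [Matrix.mulVec, dotProduct]
      refine Finset.sum_congr rfl fun s _ => ?_
      rw [hH]
      split_ifs <;> ring
    rw [this, Finset.sum_sub_distrib, Finset.sum_add_distrib, ← Finset.mul_sum, ← Finset.mul_sum,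
      Finset.sum_ite_eq, if_pos (Finset.mem_univ r)]
    ring
  rw [dotProduct, Finset.sum_congr rfl fun r _ => hrow r, ← Finset.mul_sum]
  simp only [Finset.sum_add_distrib, Finset.sum_sub_distrib, ← Finset.mul_sum]
  ring

lemma atMostOnePosEigenvalue_hessian (hL : Monotone L) (ht : ∀ q, L q ≤ t) {l : List (Fin k)}
    (hl : l.length + 2 = s + t) : AtMostOnePosEigenvalue
      (quadraticHessian (iteratedPderiv l (chromaticSymm (ferrersGraph L s t) k))) := by
  have hentry := hessian_chromaticSymm_ferrersGraph (k := k) hL ht hl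
  have hsum : ∑ i, Multiset.toFinsupp (l : Multiset (Fin k)) i = l.length := by
    simp only [Multiset.toFinsupp_apply]
    rw [Multiset.sum_count_eq_card (fun _ _ => Finset.mem_univ _)]
    rfl
  generalize Multiset.toFinsupp (l : Multiset (Fin k)) = μ at hentry hsum
  generalize quadraticHessian (iteratedPderiv l (chromaticSymm (ferrersGraph L s t) k)) = H at *
  have hsymm : H.IsSymm := by
    ext r c
    rw [Matrix.transpose_apply, hentry, hentry, add_right_comm]
  by_cases hμ : ∀ i, μ i ≤ 2
  · have hab := two_mul_card_levelSet_add hμ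
    have hN := coloringNumber_newton (s := s) hL ht (levelSet μ 2).card (levelSet μ 1).card (by omega)
    obtain ⟨c, d, h⟩ := exists_functional_nonpos (levelSet μ 1).card (levelSet μ 0).card
      (coloringNumber_nonneg hL s t _) (coloringNumber_nonneg hL s t _)
      (two_mul_coloringNumber_succ_le hL ht (levelSet μ 2).card) hN.1 hN.2
    refine atMostOnePosEigenvalue_of_hyperplane hsymm
      (fun r => c * (if μ r = 1 then 1 else 0) + d * (if μ r = 0 then 1 else 0)) fun x hx => ?_
    rw [bilinear_sum _ _ x H fun r s => (hentry r s).trans (hessianEntry_eq hμ r s)]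
    refine mul_nonpos_of_nonneg_of_nonpos (by positivity) (h _ _ _ _ (sum_levelSet_sq_le μ 1 x)
      (sum_levelSet_sq_le μ 0 x) (Finset.sum_nonneg fun r _ => ?_)
      (Finset.sum_nonneg fun r _ => ?_) ?_)
    · split_ifs <;> positivity
    · split_ifs <;> positivity
    · refine Eq.trans ?_ hx
      rw [dotProduct, Finset.mul_sum, Finset.mul_sum, ← Finset.sum_add_distrib]
      refine Finset.sum_congr rfl fun r _ => ?_
      ring
  · push Not at hμ
    obtain ⟨i, hi⟩ := hμ
    have hzero : H = 0 := by
      ext r c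
      rw [hentry]
      refine if_neg fun h => ?_
      have := h i
      rw [Finsupp.add_apply, Finsupp.add_apply] at this
      omega
    refine atMostOnePosEigenvalue_of_hyperplane hsymm 0 fun x _ => ?_
    simp [hzero]

theorem isLorentzian_chromaticSymm_ferrersGraph (hL : Monotone L) (ht : ∀ q, L q ≤ t) (s k : ℕ) :
    IsLorentzian (s + t) (chromaticSymm (ferrersGraph L s t) k) where
  isHomogeneous := by
    classical
    intro α hα
    rw [coeff_chromaticSymm_ferrersGraph hL ht] at hα
    have h : (∀ i, α i ≤ 2) ∧ ∑ i, α i = s + t := by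
      by_contra h
      exact hα (if_neg h)
    rw [← h.2, Finsupp.weight_apply, Finsupp.sum_fintype _ _ (by simp)]
    simp
  coeff_nonneg α := by
    rw [coeff_chromaticSymm]
    positivity
  mConvex := by
    classical
    let m := Nat.findGreatest (fun j => rookNumber L s j ≠ 0) s
    have hm : ∀ j, rookNumber L s j ≠ 0 ↔ j ≤ m := by
      intro j
      constructor
      · intro h
        refine Nat.le_findGreatest ?_ h
        by_contra hj
        exact h (rookNumber_eq_zero_of_lt L (by omega))
      · intro h h0
        refine Nat.findGreatest_spec (P := fun j => rookNumber L s j ≠ 0) (Nat.zero_le s) ?_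
          (rookNumber_eq_zero_of_le hL h h0)
        rw [rookNumber_zero_right]
        exact one_ne_zero
    convert isMConvex_boundedLevel (k := k) (s + t) m using 1
    ext α
    rw [Set.mem_ofPred_eq, Set.mem_ofPred_eq, coeff_chromaticSymm_ferrersGraph hL ht, ← hm,
      ← and_assoc]
    split_ifs with h
    · rw [Ne, coloringNumber_eq_zero_iff]
      exact ⟨fun h' => ⟨h, h'⟩, fun h' => h'.2⟩
    · exact ⟨fun h' => absurd rfl h', fun h' => absurd h'.1 h⟩
  hessian l hl := atMostOnePosEigenvalue_hessian hL ht hl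

end Lorentzian

/-! ### The Ferrers board of an abelian Dyck path -/

section Dyck

lemma northBefore_mono (l : List DyckStep) : Monotone (northBefore l) := by
  induction l with
  | nil => exact monotone_const
  | cons a l ih =>
    intro i j hij
    match a, i, j with
    | DyckStep.U, i, j => exact Nat.add_le_add_right (ih hij) 1
    | DyckStep.D, 0, j => exact Nat.zero_le _
    | DyckStep.D, i + 1, j + 1 => exact ih (Nat.le_of_succ_le_succ hij)

lemma northBefore_le_count (l : List DyckStep) (i : ℕ) : northBefore l i ≤ l.count DyckStep.U := by
  induction l generalizing i with
  | nil => exact Nat.zero_le _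
  | cons a l ih =>
    match a, i with
    | DyckStep.U, i => simpa [northBefore] using ih i
    | DyckStep.D, 0 => exact Nat.zero_le _
    | DyckStep.D, i + 1 => simpa [northBefore] using ih i

lemma hessenberg_mono (d : DyckWord) : Monotone (hessenberg d) := northBefore_mono d.toList

lemma hessenberg_le (d : DyckWord) (i : ℕ) : hessenberg d i ≤ d.semilength :=
  northBefore_le_count d.toList i

lemma hessenberg_zero_pos {d : DyckWord} (h : 0 < d.semilength) : 0 < hessenberg d 0 := by
  have hne : d.toList ≠ [] := by
    rw [DyckWord.toList_ne_nil]
    rintro rfl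
    simp at h
  have hhead := d.head_eq_U hne
  rw [hessenberg]
  obtain ⟨a, l, hl⟩ := List.exists_cons_of_ne_nil hne
  simp only [hl, List.head_cons] at hhead ⊢
  rw [hhead]
  exact Nat.succ_pos _

/-- If `i < j` were non-adjacent and both at least `hessenberg d 0`, then `0`, `i`, `j` would be a
triangle in the bipartite complement. -/
lemma IsAbelianDyckPath.lt_hessenberg {d : DyckWord} (hd : IsAbelianDyckPath d) {i j : ℕ}
    (hi : hessenberg d 0 ≤ i) (hij : i < j) (hj : j < d.semilength) : j < hessenberg d i := by
  by_contra hlt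
  have hpos := hessenberg_zero_pos (d := d) (by omega)
  obtain ⟨C⟩ := hd
  let a : Fin d.semilength := ⟨0, by omega⟩
  let b : Fin d.semilength := ⟨i, by omega⟩
  let c : Fin d.semilength := ⟨j, hj⟩
  have hnon : ∀ {u v : Fin d.semilength}, u < v → hessenberg d u ≤ v →
      (indifferenceGraph d)ᶜ.Adj u v := by
    intro u v huv h
    rw [SimpleGraph.compl_adj]
    refine ⟨huv.ne, ?_⟩
    rintro (⟨-, h'⟩ | ⟨h', -⟩)
    · omega
    · exact absurd huv h'.asymm
  have hab := C.valid (hnon (u := a) (v := b) (Fin.mk_lt_mk.mpr (by omega)) hi)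
  have hac := C.valid (hnon (u := a) (v := c) (Fin.mk_lt_mk.mpr (by omega)) (show hessenberg d 0 ≤ j by omega))
  have hbc := C.valid (hnon (u := b) (v := c) (Fin.mk_lt_mk.mpr hij) (not_lt.mp hlt))
  omega

/-- The indifference graph of an abelian Dyck path as the graph of a Ferrers board. Both cliques are
numbered backwards, so that the rows of the board become longer and consist of initial cells. -/
noncomputable def ferrersGraphIso {d : DyckWord} (hd : IsAbelianDyckPath d) :
    ferrersGraph (fun q => d.semilength - hessenberg d (hessenberg d 0 - 1 - q))
      (hessenberg d 0) (d.semilength - hessenberg d 0) ≃g indifferenceGraph d :=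
  have hs := hessenberg_le d 0
  let f : Fin (d.semilength - hessenberg d 0) ⊕ Fin (hessenberg d 0) → Fin d.semilength :=
    Sum.elim (fun b => ⟨d.semilength - 1 - b, by omega⟩)
      (fun q => ⟨hessenberg d 0 - 1 - q, by omega⟩)
  have hf : Function.Bijective f := by
    rw [Fintype.bijective_iff_injective_and_card]
    refine ⟨?_, ?_⟩
    · rintro (b | q) (b' | q') h <;>
        simp only [f, Sum.elim_inl, Sum.elim_inr, Fin.mk.injEq] at h <;>
        (congr 1; omega)
    · simp only [Fintype.card_sum, Fintype.card_fin]
      omega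
  { toEquiv := Equiv.ofBijective f hf
    map_rel_iff' := by
      have hl : ∀ q, hessenberg d 0 ≤ hessenberg d q := fun q => hessenberg_mono d (Nat.zero_le q)
      have hc := fun i j => hd.lt_hessenberg (i := i) (j := j)
      have hadj : ∀ u v : Fin d.semilength, (indifferenceGraph d).Adj u v ↔
          ((u : ℕ) < v ∧ (v : ℕ) < hessenberg d u) ∨ ((v : ℕ) < u ∧ (u : ℕ) < hessenberg d v) :=
        fun u v => Iff.rfl
      rintro (b | q) (b' | q')
      · rw [hadj]
        change (d.semilength - 1 - b < d.semilength - 1 - b' ∧ d.semilength - 1 - b' < _) ∨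
          (d.semilength - 1 - b' < d.semilength - 1 - b ∧ d.semilength - 1 - b < _) ↔ b ≠ b'
        rw [Ne, Fin.ext_iff]
        have h1 := hc (d.semilength - 1 - b) (d.semilength - 1 - b') (by omega)
        have h2 := hc (d.semilength - 1 - b') (d.semilength - 1 - b) (by omega)
        constructor
        · omega
        · intro h
          rcases lt_or_gt_of_ne h with h | h
          · exact Or.inr ⟨by omega, h2 (by omega) (by omega)⟩
          · exact Or.inl ⟨by omega, h1 (by omega) (by omega)⟩
      · rw [hadj]
        change (d.semilength - 1 - b < hessenberg d 0 - 1 - q' ∧ hessenberg d 0 - 1 - q' < _) ∨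
          (hessenberg d 0 - 1 - q' < d.semilength - 1 - b ∧
            d.semilength - 1 - b < hessenberg d (hessenberg d 0 - 1 - q')) ↔
          d.semilength - hessenberg d (hessenberg d 0 - 1 - q') ≤ b
        omega
      · rw [hadj]
        change (hessenberg d 0 - 1 - q < d.semilength - 1 - b' ∧
            d.semilength - 1 - b' < hessenberg d (hessenberg d 0 - 1 - q)) ∨
          (d.semilength - 1 - b' < hessenberg d 0 - 1 - q ∧ hessenberg d 0 - 1 - q < _) ↔
          d.semilength - hessenberg d (hessenberg d 0 - 1 - q) ≤ b'
        omega
      · rw [hadj]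
        change (hessenberg d 0 - 1 - q < hessenberg d 0 - 1 - q' ∧ hessenberg d 0 - 1 - q' <
            hessenberg d (hessenberg d 0 - 1 - q)) ∨
          (hessenberg d 0 - 1 - q' < hessenberg d 0 - 1 - q ∧ hessenberg d 0 - 1 - q <
            hessenberg d (hessenberg d 0 - 1 - q')) ↔ q ≠ q'
        rw [Ne, Fin.ext_iff]
        have h1 := hl (hessenberg d 0 - 1 - q)
        have h2 := hl (hessenberg d 0 - 1 - q')
        omega }

end Dyck

theorem theorem6p6 (d : DyckWord) (hd : IsAbelianDyckPath d) (k : ℕ) :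
    IsLorentzian d.semilength (chromaticSymm (indifferenceGraph d) k) := by
  rw [← chromaticSymm_eq_of_iso (ferrersGraphIso hd) k]
  have hL : Monotone fun q => d.semilength - hessenberg d (hessenberg d 0 - 1 - q) :=
    fun q q' h => Nat.sub_le_sub_left (hessenberg_mono d (by omega)) _
  have h := isLorentzian_chromaticSymm_ferrersGraph hL
    (t := d.semilength - hessenberg d 0)
    (fun q => Nat.sub_le_sub_left (hessenberg_mono d (Nat.zero_le _)) _) (hessenberg d 0) k
  rwa [Nat.add_sub_cancel' (hessenberg_le d 0)] at h
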